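/- An instance of the replenishment problem with fixed turnover times (RFTT) is a pair $(G,\tau)$, where $G$ is a finite connected undirected graph whose vertices are a depot $s$ and a finite set $V$ of clients, with edge weights $c(e)\in\mathbb{R}_{\ge 0}$, and every client $j\in V$ has a turnover time $\tau_j\in\{1,2,3,\dots\}$. A solution assigns to each day $k=1,2,3,\dots$ a tour $T_k$ (a closed walk in $G$ from $s$ to $s$) and a set $J_k\subseteq V$ of clients visited on $T_k$, where the tours repeat with some period $\ell\ge 1$, that is, $T_{k+\ell}=T_k$ for all $k\ge 1$. It is feasible if $j\in J_{t+1}\cup\dots\cup J_{t+\tau_j}$ for all $t\ge 0$ and all $j\in V$. Its cost is the average tour length $\frac1\ell\sum_{k=1}^{\ell}c(T_k)$, where $c(T)$ is the total weight of the edges of $T$ counted with multiplicity. Let $\tau'_j=2^{\lfloor\log_2\tau_j\rfloor}$ be $\tau_j$ rounded down to a power of $2$. A solution is synchronized if on each day $k\ge1$ it visits exactly the clients $j$ for which $k$ is a multiple of $\tau'_j$. Theorem. Min-avg RFTT has a deterministic polynomial-time $O(\log n)$-approximation algorithm, where $n=|V|+1$ is the number of vertices of $G$, and its solutions are synchronized.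 That is, there are a constant $C$, a polynomial $p$ and a deterministic random access machine (with unit-cost addition, subtraction and comparison of natural numbers and of real numbers, and no other arithmetic) with the following property. Given any instance $(G,\tau)$ (the number of clients, the turnover times, the adjacency matrix and the edge weights), the machine stops after at most $p\big(n^2+\sum_j b(\tau_j)\big)$ steps, where $b(\tau_j)$ is the number of binary digits of $\tau_j$, and its output consists of a number for each client, a number $m$ and tours $W_0,\dots,W_m$, which describe a solution in this way: client $j$ is visited on the days that are multiples of its number, and on day $k$ the tour is $W_{\min(v,m)}$, where $2^v$ is the largest power of $2$ dividing $k$. This solution is synchronized and feasible, and its average tour length is at most $C\log n$ times the average tour length of every feasible solution of $(G,\tau)$. -/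

import Mathlib

/-! # The replenishment problem with fixed turnover times -/

namespace RFTT

/-- An instance `(G, τ)`: a connected graph on the depot `0` and the clients `1, …, numClients`
(client `j : Fin numClients` sits at the vertex `j.succ`), a nonnegative real weight for every edge
(the values of `weight` off the edge set are never used), and a positive turnover time for every
client. -/
structure Instance where
  numClients : ℕ
  graph : SimpleGraph (Fin (numClients + 1))
  connected : graph.Connected
  weight : Sym2 (Fin (numClients + 1)) → ℝ
  weight_nonneg : ∀ e ∈ graph.edgeSet, 0 ≤ weight e
  turnover : Fin numClients → ℕ
  turnover_pos : ∀ j, 0 < turnover j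

namespace Instance

/-- A tour: a closed walk in the graph that starts and ends at the depot. -/
abbrev Tour (I : Instance) : Type := I.graph.Walk 0 0

/-- The length of a tour: the total weight of its edges, counted with multiplicity. -/
def tourLength (I : Instance) (T : I.Tour) : ℝ := (T.edges.map I.weight).sum

/-- The number `n` of vertices of the graph. -/
def numVertices (I : Instance) : ℕ := I.numClients + 1

/-- The size of the input: the number of entries of the adjacency (weight) matrix plus the total
number of binary digits of the turnover times. -/
def size (I : Instance) : ℕ := I.numVertices ^ 2 + ∑ j, Nat.size (I.turnover j)

end Instance

/-- A solution: for every day `k = 1, 2, 3, …` a tour and the set of clients visited on that tour,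
the tours repeating after `period` days.  (The value at the index `0` is not used.) -/
structure Solution (I : Instance) where
  tour : ℕ → I.Tour
  visited : ℕ → Finset (Fin I.numClients)
  mem_support : ∀ k, 1 ≤ k → ∀ j ∈ visited k, j.succ ∈ (tour k).support
  period : ℕ
  period_pos : 0 < period
  tour_add_period : ∀ k, 1 ≤ k → tour (k + period) = tour k

namespace Solution

variable {I : Instance}

/-- Every client `j` is visited at least once in any `τ_j` consecutive days. -/
def Feasible (S : Solution I) : Prop :=
  ∀ (t : ℕ) (j : Fin I.numClients), ∃ k ∈ Finset.Icc (t + 1) (t + I.turnover j), j ∈ S.visited k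

/-- The average tour length (the objective of min-avg). -/
noncomputable def avgLength (S : Solution I) : ℝ :=
  (∑ k ∈ Finset.Icc 1 S.period, I.tourLength (S.tour k)) / S.period

/-- The solution is synchronized: each client is visited exactly on the multiples of its turnover
time rounded down to a power of two. -/
def IsSynchronized (S : Solution I) : Prop :=
  ∀ k, 1 ≤ k → ∀ j, j ∈ S.visited k ↔ 2 ^ Nat.log 2 (I.turnover j) ∣ k

end Solution

/-! ## A random access machine with step count

The memory consists of two-dimensional arrays of natural numbers and two-dimensional arrays of real
numbers.  The only arithmetic operations are addition and subtraction, and the only tests are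
comparisons.  There is no multiplication, no operation that turns real numbers into natural numbers,
and the only real constant is zero. -/

/-- A memory state: `s.nat a i j` is the entry `(i, j)` of the `a`-th natural number array, and
`s.real a i j` is the entry `(i, j)` of the `a`-th real array. -/
structure State where
  nat : ℕ → ℕ → ℕ → ℕ
  real : ℕ → ℕ → ℕ → ℝ

/-- Replace the entry `(i, j)` of the `a`-th array by `x`. -/
def setEntry {α : Type} (m : ℕ → ℕ → ℕ → α) (a i j : ℕ) (x : α) : ℕ → ℕ → ℕ → α :=
  fun a' i' j' => if a' = a ∧ i' = i ∧ j' = j then x else m a' i' j'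

/-- Natural number expressions. -/
inductive NatExp where
  | const (k : ℕ)
  | get (a : ℕ) (i j : NatExp)
  | add (x y : NatExp)
  | sub (x y : NatExp)

/-- The value of a natural number expression (subtraction is truncated at zero). -/
def NatExp.eval (s : State) : NatExp → ℕ
  | const k => k
  | get a i j => s.nat a (i.eval s) (j.eval s)
  | add x y => x.eval s + y.eval s
  | sub x y => x.eval s - y.eval s

/-- Real number expressions. -/
inductive RealExp where
  | zero
  | get (a : ℕ) (i j : NatExp)
  | add (x y : RealExp)
  | sub (x y : RealExp)

/-- The value of a real number expression. -/
noncomputable def RealExp.eval (s : State) : RealExp → ℝ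
  | zero => 0
  | get a i j => s.real a (i.eval s) (j.eval s)
  | add x y => x.eval s + y.eval s
  | sub x y => x.eval s - y.eval s

/-- Tests. -/
inductive Test where
  | natLE (x y : NatExp)
  | realLE (x y : RealExp)
  | not (b : Test)
  | and (b c : Test)

/-- The truth value of a test. -/
def Test.Holds (s : State) : Test → Prop
  | natLE x y => x.eval s ≤ y.eval s
  | realLE x y => x.eval s ≤ y.eval s
  | not b => ¬ b.Holds s
  | and b c => b.Holds s ∧ c.Holds s

/-- Programs. -/
inductive Program where
  | skip
  | setNat (a : ℕ) (i j x : NatExp)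
  | setReal (a : ℕ) (i j : NatExp) (x : RealExp)
  | seq (P Q : Program)
  | cond (b : Test) (P Q : Program)
  | loop (b : Test) (P : Program)

/-- `Exec P s t s'`: the program `P`, started in the state `s`, stops after `t` steps in the state
`s'`.  A step is one assignment or one test; it carries out a number of elementary operations that
is bounded in terms of the program alone. -/
inductive Exec : Program → State → ℕ → State → Prop
  | skip (s : State) : Exec .skip s 1 s
  | setNat (a : ℕ) (i j x : NatExp) (s : State) :
      Exec (.setNat a i j x) s 1
        { s with nat := setEntry s.nat a (i.eval s) (j.eval s) (x.eval s) }
  | setReal (a : ℕ) (i j : NatExp) (x : RealExp) (s : State) :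
      Exec (.setReal a i j x) s 1
        { s with real := setEntry s.real a (i.eval s) (j.eval s) (x.eval s) }
  | seq {P Q : Program} {s s' s'' : State} {t t' : ℕ} :
      Exec P s t s' → Exec Q s' t' s'' → Exec (.seq P Q) s (t + t') s''
  | cond_true {b : Test} {P Q : Program} {s s' : State} {t : ℕ} :
      b.Holds s → Exec P s t s' → Exec (.cond b P Q) s (t + 1) s'
  | cond_false {b : Test} {P Q : Program} {s s' : State} {t : ℕ} :
      ¬ b.Holds s → Exec Q s t s' → Exec (.cond b P Q) s (t + 1) s'
  | loop_false {b : Test} {P : Program} {s : State} :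
      ¬ b.Holds s → Exec (.loop b P) s 1 s
  | loop_true {b : Test} {P : Program} {s s' s'' : State} {t t' : ℕ} :
      b.Holds s → Exec P s t s' → Exec (.loop b P) s' t' s'' →
      Exec (.loop b P) s (t + t' + 1) s''

/-- The machine is deterministic: final state and number of steps are determined by the program and
the initial state. -/
theorem Exec.deterministic {P : Program} {s s₁ s₂ : State} {t₁ t₂ : ℕ}
    (h₁ : Exec P s t₁ s₁) (h₂ : Exec P s t₂ s₂) : t₁ = t₂ ∧ s₁ = s₂ := by
  induction h₁ generalizing t₂ s₂ with
  | skip s => cases h₂; exact ⟨rfl, rfl⟩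
  | setNat a i j x s => cases h₂; exact ⟨rfl, rfl⟩
  | setReal a i j x s => cases h₂; exact ⟨rfl, rfl⟩
  | seq _ _ ih ih' =>
    cases h₂ with
    | seq k k' =>
      obtain ⟨rfl, rfl⟩ := ih k
      obtain ⟨rfl, rfl⟩ := ih' k'
      exact ⟨rfl, rfl⟩
  | cond_true hb _ ih =>
    cases h₂ with
    | cond_true _ k => obtain ⟨rfl, rfl⟩ := ih k; exact ⟨rfl, rfl⟩
    | cond_false hb' _ => exact absurd hb hb'
  | cond_false hb _ ih =>
    cases h₂ with
    | cond_true hb' _ => exact absurd hb' hb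
    | cond_false _ k => obtain ⟨rfl, rfl⟩ := ih k; exact ⟨rfl, rfl⟩
  | loop_false hb =>
    cases h₂ with
    | loop_false _ => exact ⟨rfl, rfl⟩
    | loop_true hb' _ _ => exact absurd hb' hb
  | loop_true hb _ _ ih ih' =>
    cases h₂ with
    | loop_false hb' => exact absurd hb hb'
    | loop_true _ k k' =>
      obtain ⟨rfl, rfl⟩ := ih k
      obtain ⟨rfl, rfl⟩ := ih' k'
      exact ⟨rfl, rfl⟩

/-! ## Input and output -/

open Classical in
/-- The initial memory state: natural array `0` holds the number of clients in its entry `(0, 0)`,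
natural array `1` the turnover times of the clients in its column `0`, natural array `2` the
adjacency matrix of the graph, real array `0` the weights of the edges; every other entry is zero. -/
noncomputable def Instance.input (I : Instance) : State where
  nat a i j :=
    if a = 0 ∧ i = 0 ∧ j = 0 then I.numClients
    else if a = 1 ∧ j = 0 then
      if h : i < I.numClients then I.turnover ⟨i, h⟩ else 0
    else if a = 2 then
      if h : i < I.numClients + 1 ∧ j < I.numClients + 1 then
        if I.graph.Adj ⟨i, h.1⟩ ⟨j, h.2⟩ then 1 else 0
      else 0
    else 0
  real a i j :=
    if a = 0 then
      if h : i < I.numClients + 1 ∧ j < I.numClients + 1 then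
        if I.graph.Adj ⟨i, h.1⟩ ⟨j, h.2⟩ then I.weight s(⟨i, h.1⟩, ⟨j, h.2⟩) else 0
      else 0
    else 0

/-- The memory state `s` describes the solution `S`.  Natural array `3` holds in column `0` for each
client `j` a number such that `j` is visited exactly on the multiples of this number.  Natural array
`4` holds a number `m` in its entry `(0, 0)`.  For `i = 0, …, m`, entry `(i, 0)` of natural array `5`
and row `i` of natural array `6` hold the number of edges and the successive vertices of a tour
`W_i`; the tour of day `k` is `W_i` with `i = min (v, m)`, where `2 ^ v` is the largest power of two
dividing `k`. -/
def Solution.IsDescribedBy {I : Instance} (S : Solution I) (s : State) : Prop :=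
  ∀ k, 1 ≤ k →
    (∀ j : Fin I.numClients, j ∈ S.visited k ↔ s.nat 3 j 0 ∣ k) ∧
    s.nat 5 (min (padicValNat 2 k) (s.nat 4 0 0)) 0 = (S.tour k).length ∧
    ∀ r ≤ (S.tour k).length,
      s.nat 6 (min (padicValNat 2 k) (s.nat 4 0 0)) r = (S.tour k).getVert r

end RFTT

/-! Order the clients by the exponent `level` of their rounded turnover time, ties by index, and let
`detour j` be the distance of `j` from the depot and the clients before it. Row `v` of the memory
becomes a tour through all clients of level at most `v`, built greedily: each new client is joined
to the nearest vertex of the current tour by a shortest walk, there and back. The tour contains the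
depot and all earlier clients, so client `j` adds at most `2 * detour j`. On day `k` the row used
serves exactly the clients whose rounded turnover time divides `k`, so `j` is charged once every `2
^ level j` days and the average cost is at most twice the sum of the ratios `detour j / 2 ^ level j`
(`Output.exists_solution`).

For the lower bound (`Feasible.card_mul_le`), let every client of `K` have ratio at least `α`, and
give `j` the radius `α * 2 ^ level j / 2`. Two clients of `K` are at least the sum of their radii
apart, because the later one has a long detour; hence a tour is at least twice the sum of the radii
of the clients of `K` on it. A feasible solution visits `j` on at least a fraction `1 / τ_j` of the
days, and `τ_j < 2 * 2 ^ level j`, so `|K| * α` is at most twice the average length. Thus the `i`-th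
largest ratio is at most `2 / i` times that average, and summation gives a harmonic number, hence
the logarithm (`sum_le_harmonic_mul`).

The rest is the implementation: Bellman–Ford tables give the shortest walks, the insertions update
rows of bounded length, and the number of levels is at most the input size. Correctness and step
bounds are proved together through `Runs`, with loop invariants. -/

namespace RFTT

/-! ## A program logic with step counts -/

/-- The state `s` with entry `(i, j)` of the natural array `a` replaced by `x`. -/
def State.setNat (s : State) (a i j x : ℕ) : State := { s with nat := setEntry s.nat a i j x }

/-- The state `s` with entry `(i, j)` of the real array `a` replaced by `x`. -/
noncomputable def State.setReal (s : State) (a i j : ℕ) (x : ℝ) : State :=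
  { s with real := setEntry s.real a i j x }

@[simp] theorem State.setNat_nat (s : State) (a i j x a' i' j' : ℕ) :
    (s.setNat a i j x).nat a' i' j' = if a' = a ∧ i' = i ∧ j' = j then x else s.nat a' i' j' := rfl

@[simp] theorem State.setNat_real (s : State) (a i j x : ℕ) :
    (s.setNat a i j x).real = s.real := rfl

@[simp] theorem State.setReal_real (s : State) (a i j : ℕ) (x : ℝ) (a' i' j' : ℕ) :
    (s.setReal a i j x).real a' i' j' =
      if a' = a ∧ i' = i ∧ j' = j then x else s.real a' i' j' := rfl

@[simp] theorem State.setReal_nat (s : State) (a i j : ℕ) (x : ℝ) :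
    (s.setReal a i j x).nat = s.nat := rfl

/-- The program `P`, started in `s`, stops after at most `T` steps in a state with `Q`. -/
def Runs (P : Program) (s : State) (T : ℕ) (Q : State → Prop) : Prop :=
  ∃ t s', Exec P s t s' ∧ t ≤ T ∧ Q s'

namespace Program

/-- The natural arrays that a program may write to. -/
def writesNat : Program → List ℕ
  | skip => []
  | setNat a _ _ _ => [a]
  | setReal _ _ _ _ => []
  | seq P Q => P.writesNat ++ Q.writesNat
  | cond _ P Q => P.writesNat ++ Q.writesNat
  | loop _ P => P.writesNat

/-- The real arrays that a program may write to. -/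
def writesReal : Program → List ℕ
  | skip => []
  | setNat _ _ _ _ => []
  | setReal a _ _ _ => [a]
  | seq P Q => P.writesReal ++ Q.writesReal
  | cond _ P Q => P.writesReal ++ Q.writesReal
  | loop _ P => P.writesReal

end Program

/-- The states `s` and `s'` agree on all arrays that `P` does not write to. -/
structure Frame (P : Program) (s s' : State) : Prop where
  nat : ∀ a, a ∉ P.writesNat → s'.nat a = s.nat a
  real : ∀ a, a ∉ P.writesReal → s'.real a = s.real a

theorem Frame.refl (P : Program) (s : State) : Frame P s s := ⟨fun _ _ => rfl, fun _ _ => rfl⟩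

/-- The written arrays are over-approximated syntactically, so non-membership is decidable.
Postconditions therefore need to mention only the arrays that change. -/
theorem Exec.frame {P : Program} {s s' : State} {t : ℕ} (h : Exec P s t s') : Frame P s s' := by
  induction h with
  | skip s => exact Frame.refl _ _
  | setNat a i j x s =>
    refine ⟨fun b hb => ?_, fun _ _ => rfl⟩
    have hb : b ≠ a := by simpa [Program.writesNat] using hb
    funext i' j'
    simp [setEntry, hb]
  | setReal a i j x s =>
    refine ⟨fun _ _ => rfl, fun b hb => ?_⟩
    have hb : b ≠ a := by simpa [Program.writesReal] using hb
    funext i' j'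
    simp [setEntry, hb]
  | seq _ _ ih ih' =>
    refine ⟨fun b hb => ?_, fun b hb => ?_⟩
    · simp only [Program.writesNat, List.mem_append, not_or] at hb
      rw [ih'.nat b hb.2, ih.nat b hb.1]
    · simp only [Program.writesReal, List.mem_append, not_or] at hb
      rw [ih'.real b hb.2, ih.real b hb.1]
  | cond_true _ _ ih =>
    refine ⟨fun b hb => ?_, fun b hb => ?_⟩
    · simp only [Program.writesNat, List.mem_append, not_or] at hb
      exact ih.nat b hb.1
    · simp only [Program.writesReal, List.mem_append, not_or] at hb
      exact ih.real b hb.1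
  | cond_false _ _ ih =>
    refine ⟨fun b hb => ?_, fun b hb => ?_⟩
    · simp only [Program.writesNat, List.mem_append, not_or] at hb
      exact ih.nat b hb.2
    · simp only [Program.writesReal, List.mem_append, not_or] at hb
      exact ih.real b hb.2
  | loop_false _ => exact Frame.refl _ _
  | loop_true _ _ _ ih ih' =>
    refine ⟨fun b hb => ?_, fun b hb => ?_⟩
    · rw [ih'.nat b hb, ih.nat b hb]
    · rw [ih'.real b hb, ih.real b hb]

namespace Runs

variable {P P' : Program} {s : State} {T T' : ℕ} {Q R : State → Prop}

theorem mono (h : Runs P s T R) (hT : T ≤ T') (hQ : ∀ s', R s' → Q s') : Runs P s T' Q := by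
  obtain ⟨t, s', he, ht, hR⟩ := h
  exact ⟨t, s', he, ht.trans hT, hQ s' hR⟩

theorem mono_time (h : Runs P s T Q) (hT : T ≤ T') : Runs P s T' Q := h.mono hT fun _ h => h

/-- The postcondition may be proved with the help of the frame. -/
theorem mono_frame (h : Runs P s T R) (hT : T ≤ T') (hQ : ∀ s', Frame P s s' → R s' → Q s') :
    Runs P s T' Q := by
  obtain ⟨t, s', he, ht, hR⟩ := h
  exact ⟨t, s', he, ht.trans hT, hQ s' he.frame hR⟩

theorem skip (h : Q s) : Runs .skip s 1 Q := ⟨1, s, .skip s, le_rfl, h⟩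

theorem setNat {a : ℕ} {i j x : NatExp} (h : Q (s.setNat a (i.eval s) (j.eval s) (x.eval s))) :
    Runs (.setNat a i j x) s 1 Q :=
  ⟨1, _, .setNat a i j x s, le_rfl, h⟩

theorem setReal {a : ℕ} {i j : NatExp} {x : RealExp}
    (h : Q (s.setReal a (i.eval s) (j.eval s) (x.eval s))) :
    Runs (.setReal a i j x) s 1 Q :=
  ⟨1, _, .setReal a i j x s, le_rfl, h⟩

theorem seq (h : Runs P s T R) (h' : ∀ s', Frame P s s' → R s' → Runs P' s' T' Q) :
    Runs (.seq P P') s (T + T') Q := by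
  obtain ⟨t, s', he, ht, hR⟩ := h
  obtain ⟨t', s'', he', ht', hQ⟩ := h' s' he.frame hR
  exact ⟨t + t', s'', .seq he he', by omega, hQ⟩

theorem setNat_seq {a : ℕ} {i j x : NatExp}
    (h : Runs P (s.setNat a (i.eval s) (j.eval s) (x.eval s)) T Q) :
    Runs (.seq (.setNat a i j x) P) s (T + 1) Q := by
  obtain ⟨t, s', he, ht, hQ⟩ := h
  exact ⟨1 + t, s', .seq (.setNat a i j x s) he, by omega, hQ⟩

theorem setReal_seq {a : ℕ} {i j : NatExp} {x : RealExp}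
    (h : Runs P (s.setReal a (i.eval s) (j.eval s) (x.eval s)) T Q) :
    Runs (.seq (.setReal a i j x) P) s (T + 1) Q := by
  obtain ⟨t, s', he, ht, hQ⟩ := h
  exact ⟨1 + t, s', .seq (.setReal a i j x s) he, by omega, hQ⟩

theorem cond {b : Test} (h : b.Holds s → Runs P s T Q) (h' : ¬ b.Holds s → Runs P' s T Q) :
    Runs (.cond b P P') s (T + 1) Q := by
  by_cases hb : b.Holds s
  · obtain ⟨t, s', he, ht, hQ⟩ := h hb
    exact ⟨t + 1, s', .cond_true hb he, by omega, hQ⟩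
  · obtain ⟨t, s', he, ht, hQ⟩ := h' hb
    exact ⟨t + 1, s', .cond_false hb he, by omega, hQ⟩

/-- A loop whose invariant carries a number of remaining rounds. -/
theorem loop {b : Test} (Inv : ℕ → State → Prop) (N : ℕ)
    (hstep : ∀ i s', Inv i s' → b.Holds s' → i < N ∧ Runs P s' T (Inv (i + 1))) :
    ∀ i s, i ≤ N → Inv i s →
      Runs (.loop b P) s ((N - i) * (T + 1) + 1)
        fun s' => ∃ i ≤ N, Inv i s' ∧ ¬ b.Holds s' := by
  intro i s hi
  induction hk : N - i generalizing i s with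
  | zero =>
    intro hs
    by_cases hb : b.Holds s
    · have := (hstep i s hs hb).1
      omega
    · exact ⟨1, s, .loop_false hb, by omega, i, hi, hs, hb⟩
  | succ k ih =>
    intro hs
    by_cases hb : b.Holds s
    · obtain ⟨hlt, t, s', he, ht, hs'⟩ := hstep i s hs hb
      obtain ⟨t', s'', he', ht', hQ⟩ := ih (i + 1) s' hlt (by omega) hs'
      refine ⟨t + t' + 1, s'', .loop_true hb he he', ?_, hQ⟩
      rw [Nat.succ_mul]
      omega
    · exact ⟨1, s, .loop_false hb, by omega, i, hi, hs, hb⟩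

end Runs

/-- The register `a` is the entry `(0, 0)` of the natural array `a`. -/
abbrev NatExp.reg (a : ℕ) : NatExp := .get a (.const 0) (.const 0)

/-- `for a = 0, …, e - 1 do P`, with the loop variable in register `a`. -/
def Program.forLoop (a : ℕ) (e : NatExp) (P : Program) : Program :=
  .seq (.setNat a (.const 0) (.const 0) (.const 0))
    (.loop (.natLE (.add (.reg a) (.const 1)) e)
      (.seq P (.setNat a (.const 0) (.const 0) (.add (.reg a) (.const 1)))))

/-- The rule for counting loops. -/
theorem Runs.forLoop {a : ℕ} {e : NatExp} {P : Program} {s : State} {T : ℕ} (N : ℕ)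
    (Inv : ℕ → State → Prop)
    (ha : a ∉ P.writesNat)
    (hN : ∀ s', Frame (.forLoop a e P) s s' → e.eval s' = N)
    (h0 : Inv 0 (s.setNat a 0 0 0))
    (hstep : ∀ i s', i < N → Frame (.forLoop a e P) s s' → s'.nat a 0 0 = i → Inv i s' →
      Runs P s' T fun s'' => Inv (i + 1) (s''.setNat a 0 0 (i + 1))) :
    Runs (.forLoop a e P) s (N * (T + 2) + 2) (Inv N) := by
  set F := Program.forLoop a e P with hF
  have hwn : ∀ b, b ∉ F.writesNat → b ≠ a ∧ b ∉ P.writesNat := by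
    intro b hb
    simp only [hF, Program.forLoop, Program.writesNat, List.mem_append, List.mem_singleton] at hb
    tauto
  have hwr : ∀ b, b ∉ F.writesReal → b ∉ P.writesReal := by
    intro b hb
    simpa [hF, Program.forLoop, Program.writesReal] using hb
  have frame_set : ∀ s' x, Frame F s s' → Frame F s (s'.setNat a 0 0 x) := by
    intro s' x h
    refine ⟨fun b hb => ?_, fun b hb => h.real b hb⟩
    rw [← h.nat b hb]
    funext i j
    simp [(hwn b hb).1]
  have key := Runs.loop (b := .natLE (.add (.reg a) (.const 1)) e)
    (P := .seq P (.setNat a (.const 0) (.const 0) (.add (.reg a) (.const 1)))) (T := T + 1)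
    (fun i s' => i ≤ N ∧ Frame F s s' ∧ s'.nat a 0 0 = i ∧ Inv i s') N ?_ 0 (s.setNat a 0 0 0)
    (Nat.zero_le _) ⟨Nat.zero_le _, frame_set s 0 (Frame.refl _ _), by simp, h0⟩
  · refine (Runs.setNat_seq (key.mono (T' := N * (T + 2) + 1) (by simp) ?_)).mono le_rfl
      fun _ h => h
    rintro s' ⟨i, hi, ⟨_, hf, hi', hinv⟩, hb⟩
    have he := hN s' hf
    simp only [Test.Holds, NatExp.eval, he, hi'] at hb
    obtain rfl : i = N := by omega
    exact hinv
  · rintro i s' ⟨hi, hf, hi', hinv⟩ hb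
    have he := hN s' hf
    simp only [Test.Holds, NatExp.eval, he, hi'] at hb
    have hlt : i < N := by omega
    refine ⟨hlt, (hstep i s' hlt hf hi' hinv).seq fun s'' hf' h => Runs.setNat ?_⟩
    have hsa : s''.nat a 0 0 = i := by rw [hf'.nat a ha, hi']
    have hF'' : Frame F s s'' :=
      ⟨fun b hb => by rw [hf'.nat b (hwn b hb).2, hf.nat b hb],
        fun b hb => by rw [hf'.real b (hwr b hb), hf.real b hb]⟩
    simp only [NatExp.eval, hsa]
    exact ⟨hlt, frame_set _ _ hF'', by simp, h⟩

/-! ## The shortest path computation -/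

/-- The expression for the number of clients. -/
abbrev numExp : NatExp := .get 0 (.const 0) (.const 0)

/-- `x + 1`. -/
abbrev NatExp.succ (x : NatExp) : NatExp := .add x (.const 1)

/-- The vertices `x` and `y` are adjacent or equal. -/
def Link (s : State) (x y : ℕ) : Prop := 1 ≤ s.nat 2 x y ∨ x = y

/-- Entry `(k + 1, x)` of the distance table is the minimum, over the first `N` vertices `y` that are
linked to `x` and reached in layer `k`, of the weight of `xy` plus the entry `(k, y)`. -/
def Cell (s : State) (k x N : ℕ) : Prop :=
  (s.nat 7 (k + 1) x = 0 ∨ ∃ y < N, s.nat 7 (k + 1) x = y + 1 ∧ Link s x y ∧ s.nat 7 k y ≠ 0 ∧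
    s.real 1 (k + 1) x = s.real 0 x y + s.real 1 k y) ∧
  ∀ y < N, Link s x y → s.nat 7 k y ≠ 0 →
    s.nat 7 (k + 1) x ≠ 0 ∧ s.real 1 (k + 1) x ≤ s.real 0 x y + s.real 1 k y

theorem Cell.congr {s s' : State} {k x N : ℕ} (h : Cell s k x N) (h2 : s'.nat 2 = s.nat 2)
    (h0 : s'.real 0 = s.real 0) (h7 : s'.nat 7 k = s.nat 7 k)
    (h7' : s'.nat 7 (k + 1) x = s.nat 7 (k + 1) x) (h1 : s'.real 1 k = s.real 1 k)
    (h1' : s'.real 1 (k + 1) x = s.real 1 (k + 1) x) : Cell s' k x N := by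
  unfold Cell Link at *
  rw [h2, h0, h7, h7', h1, h1']
  exact h

/-- Improve entry `(k + 1, x)` of the distance table by way of the vertex `y`. -/
def relax : Program :=
  .cond
    (.and
      (.natLE (.const 1) (.add (.get 2 (.reg 13) (.reg 14))
        (.sub (.const 1) (.add (.sub (.reg 13) (.reg 14)) (.sub (.reg 14) (.reg 13))))))
      (.and (.natLE (.const 1) (.get 7 (.reg 12) (.reg 14)))
        (.not (.and (.natLE (.const 1) (.get 7 (.succ (.reg 12)) (.reg 13)))
          (.realLE (.get 1 (.succ (.reg 12)) (.reg 13))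
            (.add (.get 0 (.reg 13) (.reg 14)) (.get 1 (.reg 12) (.reg 14))))))))
    (.seq (.setNat 7 (.succ (.reg 12)) (.reg 13) (.succ (.reg 14)))
      (.setReal 1 (.succ (.reg 12)) (.reg 13)
        (.add (.get 0 (.reg 13) (.reg 14)) (.get 1 (.reg 12) (.reg 14)))))
    .skip

/-- The pointer table (natural array 7) stores `y + 1` for the successor `y`, so that `0` can mean
"not reached". The test overwrites an entry that is unreached or strictly worse than the route
through `y`; in either case the minimum over the first `y` vertices becomes the minimum over the
first `y + 1`. -/
theorem runs_relax (s : State) (k x y : ℕ) (hk : s.nat 12 0 0 = k) (hx : s.nat 13 0 0 = x)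
    (hy : s.nat 14 0 0 = y) (hc : Cell s k x y) :
    Runs relax s 3 fun s' =>
      (∀ k' x', ¬(k' = k + 1 ∧ x' = x) →
        s'.nat 7 k' x' = s.nat 7 k' x' ∧ s'.real 1 k' x' = s.real 1 k' x') ∧
      Cell s' k x (y + 1) := by
  -- With truncated subtraction, the bracket `1 - (x - y + (y - x))` is `1` if `x = y` and `0`
  -- otherwise, so a single sum encodes the disjunction in `Link`.
  have hlink : (1 ≤ s.nat 2 x y + (1 - (x - y + (y - x)))) ↔ Link s x y := by
    unfold Link; omega
  refine Runs.cond (fun hb => ?_) (fun hb => ?_)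
  · simp only [Test.Holds, NatExp.eval, RealExp.eval, hk, hx, hy, hlink] at hb
    obtain ⟨hl, h7, hn⟩ := hb
    refine Runs.setNat_seq (Runs.setReal ?_)
    simp only [NatExp.eval, RealExp.eval, State.setNat_nat, State.setNat_real, hk, hx, hy,
      Nat.reduceEqDiff, false_and, if_false]
    refine ⟨fun k' x' h => by simp [h], ?_⟩
    have hl' := hl
    unfold Cell Link at *
    simp only [State.setNat_nat, State.setNat_real, State.setReal_nat, State.setReal_real,
      Nat.reduceEqDiff, false_and, if_false, true_and, and_self, if_true, zero_ne_one,
      (Nat.lt_succ_self k).ne]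
    refine ⟨Or.inr ⟨y, by omega, rfl, hl, by omega, by simp⟩, ?_⟩
    intro y' hy' hl' h7'
    refine ⟨by omega, ?_⟩
    rcases Nat.lt_succ_iff_lt_or_eq.1 hy' with h | rfl
    · obtain ⟨h1, h2⟩ := hc.2 y' h hl' h7'
      have := hn
      simp only [not_and, not_le] at this
      have := this (by omega)
      linarith
    · linarith
  · simp only [Test.Holds, NatExp.eval, RealExp.eval, hk, hx, hy, hlink] at hb
    refine Runs.mono (T := 1) (Runs.skip (Q := fun s' => _) ⟨fun _ _ _ => ⟨rfl, rfl⟩, ?_, ?_⟩)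
      (by omega) (fun _ h => h)
    · rcases hc.1 with h | ⟨y', h, h'⟩
      · exact Or.inl h
      · exact Or.inr ⟨y', by omega, h'⟩
    · intro y' hy' hl' h7'
      rcases Nat.lt_succ_iff_lt_or_eq.1 hy' with h | rfl
      · exact hc.2 y' h hl' h7'
      · by_contra hcon
        exact hb ⟨hl', by omega, fun h => hcon ⟨by omega, h.2⟩⟩

/-- Compute entry `(k + 1, x)` of the distance table. -/
def bellmanCell : Program :=
  .seq (.setNat 7 (.succ (.reg 12)) (.reg 13) (.const 0)) (.forLoop 14 (.succ numExp) relax)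

/-- Only the pointer is reset. A stale distance is harmless, since a zero pointer makes the
relaxation test disregard it. -/
theorem runs_bellmanCell (s : State) (n k x : ℕ) (hn : s.nat 0 0 0 = n) (hk : s.nat 12 0 0 = k)
    (hx : s.nat 13 0 0 = x) :
    Runs bellmanCell s ((n + 1) * 5 + 3) fun s' =>
      (∀ k' x', ¬(k' = k + 1 ∧ x' = x) →
        s'.nat 7 k' x' = s.nat 7 k' x' ∧ s'.real 1 k' x' = s.real 1 k' x') ∧
      Cell s' k x (n + 1) := by
  refine Runs.setNat_seq ?_
  simp only [NatExp.eval, hk, hx]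
  refine Runs.forLoop (n + 1) (fun y s' =>
      (∀ k' x', ¬(k' = k + 1 ∧ x' = x) →
        s'.nat 7 k' x' = s.nat 7 k' x' ∧ s'.real 1 k' x' = s.real 1 k' x') ∧
      Cell s' k x y) (by decide) ?_ ?_ ?_
  · intro s' hf
    simp [NatExp.eval, hf.nat 0 (by decide), hn]
  · refine ⟨fun k' x' h => by simp [h], ?_, by simp⟩
    left; simp
  · intro y s' hy hf hy' ⟨h1, h2⟩
    refine (runs_relax s' k x y ?_ ?_ hy' h2).mono le_rfl ?_
    · rw [hf.nat 12 (by decide)]; simpa using hk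
    · rw [hf.nat 13 (by decide)]; simpa using hx
    · rintro s'' ⟨h3, h4⟩
      refine ⟨fun k' x' h => ?_, h4.congr ?_ rfl ?_ ?_ rfl rfl⟩
      · have := h1 k' x' h
        have := h3 k' x' h
        simp_all
      · funext a b; simp
      · funext b; simp
      · simp

/-- Fill the distance table for walks that end in the client `j`. -/
def bellman : Program :=
  .seq (.forLoop 13 (.succ numExp) (.setNat 7 (.const 0) (.reg 13) (.const 0)))
    (.seq (.setNat 7 (.const 0) (.succ (.reg 11)) (.const 1))
      (.seq (.setReal 1 (.const 0) (.succ (.reg 11)) .zero)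
        (.forLoop 12 numExp (.forLoop 13 (.succ numExp) bellmanCell))))

/-- The distance table for walks that end in the vertex `t`. -/
structure Table (s : State) (n t : ℕ) : Prop where
  reached_zero : ∀ x < n + 1, s.nat 7 0 x ≠ 0 ↔ x = t
  dist_zero : s.real 1 0 t = 0
  cell : ∀ k < n, ∀ x < n + 1, Cell s k x (n + 1)

/-- A bound on the number of steps of `bellman`. -/
def bellmanTime (n : ℕ) : ℕ :=
  (n + 1) * 3 + 2 + (n * ((n + 1) * ((n + 1) * 5 + 3 + 2) + 2 + 2) + 2 + 1 + 1)

theorem runs_bellmanRow (s : State) (n k : ℕ) (hn : s.nat 0 0 0 = n) (hk : s.nat 12 0 0 = k) :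
    Runs (.forLoop 13 (.succ numExp) bellmanCell) s ((n + 1) * ((n + 1) * 5 + 3 + 2) + 2) fun s' =>
      (∀ k' ≠ k + 1, s'.nat 7 k' = s.nat 7 k' ∧ s'.real 1 k' = s.real 1 k') ∧
      ∀ x < n + 1, Cell s' k x (n + 1) := by
  refine Runs.forLoop (n + 1) (fun x s' =>
      (∀ k' ≠ k + 1, s'.nat 7 k' = s.nat 7 k' ∧ s'.real 1 k' = s.real 1 k') ∧
      ∀ x' < x, Cell s' k x' (n + 1)) (by decide) ?_ ?_ ?_
  · intro s' hf
    simp [NatExp.eval, hf.nat 0 (by decide), hn]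
  · refine ⟨fun k' h => ⟨?_, rfl⟩, by simp⟩
    funext b; simp
  · intro x s' hx hf hx' ⟨h1, h2⟩
    refine (runs_bellmanCell s' n k x ?_ ?_ hx').mono_frame le_rfl ?_
    · rw [hf.nat 0 (by decide)]; exact hn
    · rw [hf.nat 12 (by decide)]; exact hk
    · rintro s'' hf' ⟨h3, h4⟩
      have hs : ∀ a ≠ 13, (s''.setNat 13 0 0 (x + 1)).nat a = s''.nat a := by
        intro a ha; funext i j; simp [ha]
      refine ⟨fun k' h => ⟨?_, ?_⟩, fun x' hx' => ?_⟩
      · rw [hs 7 (by decide), ← (h1 k' h).1]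
        funext b; exact (h3 k' b (by tauto)).1
      · rw [← (h1 k' h).2]
        funext b; exact (h3 k' b (by tauto)).2
      · rcases Nat.lt_succ_iff_lt_or_eq.1 hx' with h | rfl
        · refine (h2 x' h).congr ?_ ?_ ?_ ?_ ?_ ?_
          · rw [hs 2 (by decide), hf'.nat 2 (by decide)]
          · exact hf'.real 0 (by decide)
          · rw [hs 7 (by decide)]; funext b; exact (h3 k b (by omega)).1
          · rw [hs 7 (by decide)]; exact (h3 (k + 1) x' (by omega)).1
          · funext b; exact (h3 k b (by omega)).2
          · exact (h3 (k + 1) x' (by omega)).2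
        · exact h4.congr (hs 2 (by decide)) rfl (by rw [hs 7 (by decide)])
            (by rw [hs 7 (by decide)]) rfl rfl

theorem runs_bellman (s : State) (n j : ℕ) (hn : s.nat 0 0 0 = n) (hj : s.nat 11 0 0 = j) :
    Runs bellman s (bellmanTime n) fun s' => Table s' n (j + 1) := by
  refine Runs.seq (R := fun s' => ∀ x < n + 1, s'.nat 7 0 x = 0)
    (Runs.forLoop (T := 1) (n + 1) (fun x s' => ∀ x' < x, s'.nat 7 0 x' = 0) (by decide) ?_ ?_ ?_)
      fun s₁ hf₁ h₁ => ?_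
  · intro s' hf
    simp [NatExp.eval, hf.nat 0 (by decide), hn]
  · simp
  · intro x s' hx hf hx' h
    refine Runs.setNat ?_
    intro x' hlt
    simp only [NatExp.eval, hx', State.setNat_nat]
    rcases Nat.lt_succ_iff_lt_or_eq.1 hlt with h' | rfl
    · simp [h x' h']
    · simp
  refine Runs.setNat_seq (Runs.setReal_seq ?_)
  have hj₁ : s₁.nat 11 0 0 = j := by rw [hf₁.nat 11 (by decide)]; exact hj
  simp only [NatExp.eval, RealExp.eval, hj₁, State.setNat_nat]
  simp only [Nat.reduceEqDiff, false_and, if_false]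
  refine (Runs.forLoop n (fun k s' => (∀ x < n + 1, s'.nat 7 0 x ≠ 0 ↔ x = j + 1) ∧
    s'.real 1 0 (j + 1) = 0 ∧ ∀ k' < k, ∀ x < n + 1, Cell s' k' x (n + 1)) (by decide) ?_ ?_
    ?_).mono le_rfl fun s' h => ⟨h.1, h.2.1, h.2.2⟩
  · intro s' hf
    simp only [NatExp.eval, hf.nat 0 (by decide)]
    simp [hf₁.nat 0 (by decide), hn]
  · refine ⟨fun x hx => ?_, by simp, by simp⟩
    by_cases h : x = j + 1 <;> simp [h, h₁ x hx]
  · intro k s' hk hf hk' ⟨h1, h2, h3⟩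
    refine (runs_bellmanRow s' n k ?_ hk').mono_frame le_rfl ?_
    · rw [hf.nat 0 (by decide)]; simp [hf₁.nat 0 (by decide), hn]
    · rintro s'' hf' ⟨h4, h5⟩
      have hs : ∀ a ≠ 12, (s''.setNat 12 0 0 (k + 1)).nat a = s''.nat a := by
        intro a ha; funext i j; simp [ha]
      have h40 := h4 0 (by omega)
      refine ⟨fun x hx => ?_, ?_, fun k' hlt x hx => ?_⟩
      · rw [hs 7 (by decide), h40.1]; exact h1 x hx
      · rw [State.setNat_real, h40.2]; exact h2
      · rcases Nat.lt_succ_iff_lt_or_eq.1 hlt with h | rfl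
        · refine (h3 k' h x hx).congr ?_ ?_ ?_ ?_ ?_ ?_
          · rw [hs 2 (by decide), hf'.nat 2 (by decide)]
          · exact hf'.real 0 (by decide)
          · rw [hs 7 (by decide)]; exact (h4 k' (by omega)).1
          · rw [hs 7 (by decide), (h4 (k' + 1) (by omega)).1]
          · exact (h4 k' (by omega)).2
          · rw [State.setNat_real, (h4 (k' + 1) (by omega)).2]
        · exact (h5 x hx).congr (hs 2 (by decide)) rfl (by rw [hs 7 (by decide)])
            (by rw [hs 7 (by decide)]) rfl rfl

/-! ## Tours in the memory -/

/-- The expression for the length of the tour in the current row. -/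
abbrev lenExp : NatExp := .get 5 (.reg 10) (.const 0)

/-- The expression for a vertex of the tour in the current row. -/
abbrev rowExp (r : NatExp) : NatExp := .get 6 (.reg 10) r

/-- Find a position of the current row with the smallest distance. -/
def select : Program :=
  .seq (.setNat 15 (.const 0) (.const 0) (.const 0))
    (.forLoop 16 (.succ lenExp)
      (.cond (.not (.realLE (.get 1 numExp (rowExp (.reg 15))) (.get 1 numExp (rowExp (.reg 16)))))
        (.setNat 15 (.const 0) (.const 0) (.reg 16)) .skip))

/-- Distances are compared without looking at the pointers. This is sound in the application: the
graph is connected, so layer `n` reaches every vertex. -/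
theorem runs_select (s : State) (n v l : ℕ) (hn : s.nat 0 0 0 = n) (hv : s.nat 10 0 0 = v)
    (hl : s.nat 5 v 0 = l) :
    Runs select s ((l + 1) * 4 + 3) fun s' => s'.nat 15 0 0 ≤ l ∧
      ∀ r ≤ l, s.real 1 n (s.nat 6 v (s'.nat 15 0 0)) ≤ s.real 1 n (s.nat 6 v r) := by
  refine Runs.setNat_seq ?_
  simp only [NatExp.eval]
  refine (Runs.forLoop (T := 2) (l + 1) (fun i s' => s'.nat 15 0 0 ≤ l ∧
      ∀ r < i, s.real 1 n (s.nat 6 v (s'.nat 15 0 0)) ≤ s.real 1 n (s.nat 6 v r))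
      (by decide) ?_ ?_ ?_).mono le_rfl fun s' h => ⟨h.1, fun r hr => h.2 r (by omega)⟩
  · intro s' hf
    simp [NatExp.eval, hf.nat 5 (by decide), hf.nat 10 (by decide), hv, hl]
  · simp
  · intro i s' hi hf hi' ⟨h1, h2⟩
    have e0 : s'.nat 0 0 0 = n := by rw [hf.nat 0 (by decide)]; simpa using hn
    have e10 : s'.nat 10 0 0 = v := by rw [hf.nat 10 (by decide)]; simpa using hv
    have e6 : s'.nat 6 = s.nat 6 := by rw [hf.nat 6 (by decide)]; funext a b; simp
    have e1 : s'.real 1 = s.real 1 := hf.real 1 (by decide)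
    refine Runs.cond (fun hb => Runs.setNat ?_) fun hb => Runs.skip ?_
    · simp only [Test.Holds, NatExp.eval, RealExp.eval, e0, e10, e6, e1, hi', not_le] at hb
      simp only [NatExp.eval, State.setNat_nat, Nat.reduceEqDiff, false_and, if_false, and_self,
        if_true, hi']
      refine ⟨by omega, fun r hr => ?_⟩
      rcases Nat.lt_succ_iff_lt_or_eq.1 hr with h | rfl
      · exact hb.le.trans (h2 r h)
      · exact le_rfl
    · simp only [Test.Holds, NatExp.eval, RealExp.eval, e0, e10, e6, e1, hi', not_not] at hb
      simp only [State.setNat_nat, Nat.reduceEqDiff, false_and, if_false]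
      refine ⟨h1, fun r hr => ?_⟩
      rcases Nat.lt_succ_iff_lt_or_eq.1 hr with h | rfl
      · exact h2 r h
      · exact hb

/-- Insert the vertex in register `14`, and the way back, after the position in register `15`. -/
def insertVertex : Program :=
  .seq
    (.forLoop 16 (.sub (.succ lenExp) (.reg 15))
      (.setNat 6 (.reg 10) (.add (.sub lenExp (.reg 16)) (.const 2))
        (rowExp (.sub lenExp (.reg 16)))))
    (.seq (.setNat 6 (.reg 10) (.succ (.reg 15)) (.reg 14))
      (.setNat 5 (.reg 10) (.const 0) (.add lenExp (.const 2))))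

/-- The entries from position `p` on move two places to the right, starting from the end so that
nothing is overwritten before it is copied. The old vertex at `p` then stands at both `p` and `p +
2`, and `y` goes in between. -/
theorem runs_insertVertex (s : State) (v p y l : ℕ) (hv : s.nat 10 0 0 = v)
    (hp : s.nat 15 0 0 = p) (hy : s.nat 14 0 0 = y) (hl : s.nat 5 v 0 = l) (hpl : p ≤ l) :
    Runs insertVertex s ((l + 1) * 3 + 4) fun s' =>
      (∀ v' ≠ v, s'.nat 5 v' = s.nat 5 v' ∧ s'.nat 6 v' = s.nat 6 v') ∧
      s'.nat 5 v 0 = l + 2 ∧ (∀ q ≤ p, s'.nat 6 v q = s.nat 6 v q) ∧ s'.nat 6 v (p + 1) = y ∧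
      ∀ q, p ≤ q → q ≤ l → s'.nat 6 v (q + 2) = s.nat 6 v q := by
  refine (Runs.seq (Runs.forLoop (T := 1) (l + 1 - p) (fun i s' =>
      (∀ v' ≠ v, s'.nat 6 v' = s.nat 6 v') ∧ (∀ q, q + i ≤ l + 1 → s'.nat 6 v q = s.nat 6 v q) ∧
      ∀ q ≤ l, l < q + i → s'.nat 6 v (q + 2) = s.nat 6 v q) (by decide) ?_ ?_ ?_)
    (T' := 2) fun s₁ hf₁ ⟨h1, h2, h3⟩ => ?_).mono ?_ fun _ h => h
  · intro s' hf
    simp [NatExp.eval, hf.nat 5 (by decide), hf.nat 10 (by decide), hf.nat 15 (by decide), hv, hl,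
      hp]
  · refine ⟨fun v' _ => ?_, fun q _ => by simp, fun q h h' => by omega⟩
    funext b; simp
  · intro i s' hi hf hi' ⟨h1, h2, h3⟩
    refine Runs.setNat ?_
    have e10 : s'.nat 10 0 0 = v := by rw [hf.nat 10 (by decide)]; exact hv
    have e5 : s'.nat 5 v 0 = l := by rw [hf.nat 5 (by decide)]; exact hl
    simp only [NatExp.eval, e10, e5, hi', State.setNat_nat]
    simp only [Nat.reduceEqDiff, false_and, if_false, true_and]
    refine ⟨fun v' hv' => ?_, fun q hq => ?_, fun q hq hq' => ?_⟩
    · rw [← h1 v' hv']; funext b; simp [hv']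
    · rw [if_neg (by omega)]; exact h2 q (by omega)
    · by_cases h : q = l - i
      · rw [if_pos (by omega), ← h]; exact h2 q (by omega)
      · rw [if_neg (by omega)]; exact h3 q hq (by omega)
  · have e10 : s₁.nat 10 0 0 = v := by rw [hf₁.nat 10 (by decide)]; exact hv
    have e14 : s₁.nat 14 0 0 = y := by rw [hf₁.nat 14 (by decide)]; exact hy
    have e15 : s₁.nat 15 0 0 = p := by rw [hf₁.nat 15 (by decide)]; exact hp
    have e5 : s₁.nat 5 = s.nat 5 := hf₁.nat 5 (by decide)
    refine Runs.setNat_seq (Runs.setNat ?_)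
    simp only [NatExp.eval, e10, e14, e15, State.setNat_nat]
    simp only [Nat.reduceEqDiff, false_and, if_false, true_and, e5, hl, and_self, if_true]
    refine ⟨fun v' hv' => ⟨?_, ?_⟩, fun q hq => ?_, fun q hq hq' => ?_⟩
    · funext b; simp [hv', e5]
    · rw [← h1 v' hv']; funext b; simp [hv']
    · rw [if_neg (by omega)]; exact h2 q (by omega)
    · rw [if_neg (by omega)]; exact h3 q hq' (by omega)
  · have : (l + 1 - p) * (1 + 2) ≤ (l + 1) * 3 := Nat.mul_le_mul (by omega) (by omega)
    omega

/-- Extend the current row along the pointers of the distance table. -/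
def insertPath : Program :=
  .forLoop 12 numExp
    (.seq (.setNat 14 (.const 0) (.const 0)
        (.sub (.get 7 (.sub numExp (.reg 12)) (rowExp (.reg 15))) (.const 1)))
      (.cond (.and (.natLE (.reg 14) (rowExp (.reg 15))) (.natLE (rowExp (.reg 15)) (.reg 14)))
        .skip
        (.seq insertVertex (.setNat 15 (.const 0) (.const 0) (.succ (.reg 15))))))

/-- Copy the current row to the next one. -/
def copyRow : Program :=
  .seq (.setNat 5 (.succ (.reg 10)) (.const 0) lenExp)
    (.forLoop 16 (.succ lenExp)
      (.setNat 6 (.succ (.reg 10)) (.reg 16) (rowExp (.reg 16))))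

theorem runs_copyRow (s : State) (v l : ℕ) (hv : s.nat 10 0 0 = v) (hl : s.nat 5 v 0 = l) :
    Runs copyRow s ((l + 1) * 3 + 3) fun s' =>
      (∀ v' ≠ v + 1, s'.nat 5 v' = s.nat 5 v' ∧ s'.nat 6 v' = s.nat 6 v') ∧
      s'.nat 5 (v + 1) 0 = l ∧ ∀ q ≤ l, s'.nat 6 (v + 1) q = s.nat 6 v q := by
  refine Runs.setNat_seq ?_
  simp only [NatExp.eval, hv, hl]
  refine (Runs.forLoop (T := 1) (l + 1) (fun i s' => (∀ v' ≠ v + 1, s'.nat 6 v' = s.nat 6 v') ∧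
    ∀ q < i, s'.nat 6 (v + 1) q = s.nat 6 v q) (by decide) ?_ ?_ ?_).mono_frame le_rfl
    fun s' hf h => ⟨fun v' hv' => ⟨?_, h.1 v' hv'⟩, ?_, fun q hq => h.2 q (by omega)⟩
  · intro s' hf
    simp [NatExp.eval, hf.nat 5 (by decide), hf.nat 10 (by decide), hv, hl]
  · refine ⟨fun v' _ => ?_, by simp⟩
    funext b; simp
  · intro i s' hi hf hi' ⟨h1, h2⟩
    have e10 : s'.nat 10 0 0 = v := by rw [hf.nat 10 (by decide)]; simpa using hv
    refine Runs.setNat ?_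
    simp only [NatExp.eval, e10, hi', h1 v (by omega), State.setNat_nat]
    simp only [Nat.reduceEqDiff, false_and, if_false, true_and]
    refine ⟨fun v' hv' => ?_, fun q hq => ?_⟩
    · rw [← h1 v' hv']; funext b; simp [hv']
    · rcases Nat.lt_succ_iff_lt_or_eq.1 hq with h | rfl
      · rw [if_neg (by omega)]; exact h2 q h
      · simp
  · rw [hf.nat 5 (by decide)]; funext b; simp [hv']
  · rw [hf.nat 5 (by decide)]; simp

/-! ### Weights of walks, and detours inserted into a walk. -/

namespace Instance

variable (I : Instance)

/-- The total weight of the edges of a walk. -/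
def walkWeight {u v : Fin (I.numClients + 1)} (p : I.graph.Walk u v) : ℝ :=
  (p.edges.map I.weight).sum

variable {I} {u v w : Fin (I.numClients + 1)}

@[simp] theorem walkWeight_nil : I.walkWeight (.nil : I.graph.Walk u u) = 0 := by
  simp [walkWeight]

@[simp] theorem walkWeight_cons (h : I.graph.Adj u v) (p : I.graph.Walk v w) :
    I.walkWeight (.cons h p) = I.weight s(u, v) + I.walkWeight p := by
  simp [walkWeight]

theorem walkWeight_append (p : I.graph.Walk u v) (q : I.graph.Walk v w) :
    I.walkWeight (p.append q) = I.walkWeight p + I.walkWeight q := by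
  simp [walkWeight]

theorem walkWeight_reverse (p : I.graph.Walk u v) :
    I.walkWeight p.reverse = I.walkWeight p := by
  simp [walkWeight, List.sum_reverse]

theorem walkWeight_nonneg (p : I.graph.Walk u v) : 0 ≤ I.walkWeight p := by
  induction p with
  | nil => simp
  | cons h p ih =>
    rw [walkWeight_cons]
    exact add_nonneg (I.weight_nonneg _ h) ih

/-- Cutting out the cycles leaves a path, and with nonnegative weights this does not increase the
total. Hence `numClients` layers of the distance table suffice. -/
theorem exists_walk_length_le (p : I.graph.Walk u v) :
    ∃ q : I.graph.Walk u v, q.length ≤ I.numClients ∧ I.walkWeight q ≤ I.walkWeight p := by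
  classical
  refine ⟨p.bypass, ?_, ?_⟩
  · have := p.bypass_isPath.length_lt
    simp only [Fintype.card_fin] at this
    omega
  · refine (p.edges_bypass_sublist_edges.map I.weight).sum_le_sum fun a ha => ?_
    obtain ⟨e, he, rfl⟩ := List.mem_map.1 ha
    exact I.weight_nonneg e (p.edges_subset_edgeSet he)

/-- A walk may be extended by a detour to a neighbour of one of its vertices and back. -/
theorem exists_insert (W : I.graph.Walk u v) (p : ℕ) (hp : p ≤ W.length)
    (y : Fin (I.numClients + 1)) (h : I.graph.Adj (W.getVert p) y) :
    ∃ W' : I.graph.Walk u v, W'.length = W.length + 2 ∧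
      I.walkWeight W' = I.walkWeight W + 2 * I.weight s(W.getVert p, y) ∧
      (∀ q ≤ p, W'.getVert q = W.getVert q) ∧ W'.getVert (p + 1) = y ∧
      ∀ q, p ≤ q → W'.getVert (q + 2) = W.getVert q := by
  induction W generalizing p with
  | nil =>
    obtain rfl : p = 0 := by simpa using hp
    have h' := h
    rw [SimpleGraph.Walk.getVert_zero] at h'
    refine ⟨.cons h' (.cons h'.symm .nil), by simp, ?_, by simp, by simp, by simp⟩
    simp [Sym2.eq_swap (a := y)]
    ring
  | @cons a b _ hab W ih =>
    cases p with
    | zero =>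
      have h' : I.graph.Adj a y := by simpa using h
      refine ⟨.cons h' (.cons h'.symm (.cons hab W)), by simp, ?_, by simp, by simp, by simp⟩
      simp [Sym2.eq_swap (a := y)]
      ring
    | succ p =>
      obtain ⟨W', h1, h2, h3, h4, h5⟩ := ih p (by simpa using hp) (by simpa using h)
      refine ⟨.cons hab W', by simp [h1], ?_, fun q hq => ?_, by simpa using h4, fun q hq => ?_⟩
      · simp [h2]; ring
      · cases q with
        | zero => simp
        | succ q => simpa using h3 q (by omega)
      · cases q with
        | zero => omega
        | succ q => simpa using h5 q (by omega)

end Instance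

/-- Row `v` of the memory holds the tour `W`. -/
def RowOf {I : Instance} (s : State) (v : ℕ) (W : I.Tour) : Prop :=
  s.nat 5 v 0 = W.length ∧ ∀ r ≤ W.length, s.nat 6 v r = W.getVert r

theorem RowOf.congr {I : Instance} {s s' : State} {v : ℕ} {W : I.Tour} (h : RowOf s v W)
    (h5 : s'.nat 5 v = s.nat 5 v) (h6 : s'.nat 6 v = s.nat 6 v) : RowOf s' v W := by
  unfold RowOf
  rw [h5, h6]
  exact h

/-- The memory still holds the instance. -/
structure HoldsInput (I : Instance) (s : State) : Prop where
  num : s.nat 0 = I.input.nat 0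
  turnover : s.nat 1 = I.input.nat 1
  adj : s.nat 2 = I.input.nat 2
  weight : s.real 0 = I.input.real 0

namespace HoldsInput

variable {I : Instance} {s s' : State}

theorem num_eq (h : HoldsInput I s) : s.nat 0 0 0 = I.numClients := by
  rw [h.num]; simp [Instance.input]

theorem link_iff (h : HoldsInput I s) (x y : Fin (I.numClients + 1)) :
    Link s x y ↔ I.graph.Adj x y ∨ x = y := by
  classical
  have : I.input.nat 2 x y = if I.graph.Adj x y then 1 else 0 := by
    simp [Instance.input, Nat.lt_succ_iff.1 x.2, Nat.lt_succ_iff.1 y.2]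
  unfold Link
  rw [h.adj, this, Fin.ext_iff]
  by_cases hxy : I.graph.Adj x y <;> simp [hxy]

theorem weight_eq (h : HoldsInput I s) (x y : Fin (I.numClients + 1)) (hxy : I.graph.Adj x y) :
    s.real 0 x y = I.weight s(x, y) := by
  classical
  have : I.input.real 0 x y = if I.graph.Adj x y then I.weight s(x, y) else 0 := by
    simp only [Instance.input, if_true]
    rw [dif_pos ⟨x.2, y.2⟩]
  rw [h.weight, this, if_pos hxy]

theorem weight_self (h : HoldsInput I s) (x : Fin (I.numClients + 1)) : s.real 0 x x = 0 := by
  rw [h.weight]; simp [Instance.input]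

theorem turnover_eq (h : HoldsInput I s) (j : Fin I.numClients) : s.nat 1 j 0 = I.turnover j := by
  rw [h.turnover]; simp [Instance.input]

/-- A program that does not write to the input keeps it. -/
theorem frame (h : HoldsInput I s) {P : Program} (hf : Frame P s s')
    (h0 : 0 ∉ P.writesNat) (h1 : 1 ∉ P.writesNat) (h2 : 2 ∉ P.writesNat) (hr : 0 ∉ P.writesReal) : HoldsInput I s' :=
  ⟨(hf.nat 0 h0).trans h.num, (hf.nat 1 h1).trans h.turnover, (hf.nat 2 h2).trans h.adj,
    (hf.real 0 hr).trans h.weight⟩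

/-- The distance table bounds the weights of all walks. -/
theorem table_le (h : HoldsInput I s) {t : Fin (I.numClients + 1)} (ht : Table s I.numClients t)
    {x : Fin (I.numClients + 1)} (p : I.graph.Walk x t) :
    ∀ k, p.length ≤ k → k ≤ I.numClients → s.nat 7 k x ≠ 0 ∧ s.real 1 k x ≤ I.walkWeight p := by
  intro k
  induction k generalizing x with
  | zero =>
    intro hp _
    have := SimpleGraph.Walk.eq_of_length_eq_zero (Nat.le_zero.1 hp)
    subst this
    refine ⟨(ht.reached_zero _ (Fin.is_lt _)).2 rfl, ?_⟩
    rw [ht.dist_zero]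
    exact Instance.walkWeight_nonneg p
  | succ k ih =>
    intro hp hk
    obtain ⟨-, hc⟩ := ht.cell k (by omega) x x.2
    cases p with
    -- A vertex is linked to itself at weight zero, so a walk shorter than the layer number is still
    -- accounted for: layer `k` covers all walks with at most `k` edges.
    | nil =>
      obtain ⟨h1, h2⟩ := ih .nil (by simp) (by omega)
      obtain ⟨h3, h4⟩ := hc _ (Fin.is_lt _) ((h.link_iff _ _).2 (.inr rfl)) h1
      refine ⟨h3, h4.trans ?_⟩
      rw [h.weight_self]
      simpa using h2
    | @cons _ y _ hxy p =>
      obtain ⟨h1, h2⟩ := ih p (by simpa using hp) (by omega)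
      obtain ⟨h3, h4⟩ := hc y y.2 ((h.link_iff x y).2 (.inl hxy)) h1
      refine ⟨h3, h4.trans ?_⟩
      rw [h.weight_eq x y hxy, Instance.walkWeight_cons]
      linarith

end HoldsInput

/-- A bound on the number of steps of `insertPath` for rows of length at most `L`. -/
def insertPathTime (n L : ℕ) : ℕ := n * ((L + 1) * 3 + 4 + 1 + 1 + 1 + 2) + 2

/-- Round `i` follows one pointer, from layer `n - i` to the layer below. It either stays at its
vertex or inserts the edge to the next vertex and back, and then continues from there. The weight of
the tour plus twice the remaining distance never increases. After `n` rounds the layer is `0`, so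
the current vertex is `t` and the remaining distance is zero. -/
theorem runs_insertPath {I : Instance} {s : State} (h : HoldsInput I s)
    {t : Fin (I.numClients + 1)} (ht : Table s I.numClients t) {v p L : ℕ}
    (hv : s.nat 10 0 0 = v) (hp : s.nat 15 0 0 = p) {W : I.Tour} (hW : RowOf s v W)
    (hpW : p ≤ W.length) (hL : W.length + 2 * I.numClients ≤ L)
    (hreach : s.nat 7 I.numClients (W.getVert p) ≠ 0) :
    Runs insertPath s (insertPathTime I.numClients L) fun s' =>
      (∀ v' ≠ v, s'.nat 5 v' = s.nat 5 v' ∧ s'.nat 6 v' = s.nat 6 v') ∧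
      ∃ W' : I.Tour, RowOf s' v W' ∧ W.support ⊆ W'.support ∧ t ∈ W'.support ∧
        W'.length ≤ W.length + 2 * I.numClients ∧
        I.tourLength W' ≤ I.tourLength W + 2 * s.real 1 I.numClients (W.getVert p) := by
  set n := I.numClients with hn
  refine (Runs.forLoop (T := (L + 1) * 3 + 4 + 1 + 1 + 1) n (fun i s' =>
    (∀ v' ≠ v, s'.nat 5 v' = s.nat 5 v' ∧ s'.nat 6 v' = s.nat 6 v') ∧
      ∃ W' : I.Tour, RowOf s' v W' ∧ W.support ⊆ W'.support ∧
        W'.length ≤ W.length + 2 * i ∧ s'.nat 15 0 0 ≤ W'.length ∧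
        s.nat 7 (n - i) (W'.getVert (s'.nat 15 0 0)) ≠ 0 ∧
        I.walkWeight W' + 2 * s.real 1 (n - i) (W'.getVert (s'.nat 15 0 0)) ≤
          I.walkWeight W + 2 * s.real 1 n (W.getVert p)) (by decide) ?_ ?_ ?_).mono le_rfl ?_
  · intro s' hf
    simp only [NatExp.eval, hf.nat 0 (by decide)]
    exact h.num_eq
  · refine ⟨fun v' _ => ⟨?_, ?_⟩, W, ⟨?_, fun r hr => ?_⟩, by simp, by simp, ?_, ?_, ?_⟩
    · funext b; simp
    · funext b; simp
    · simpa using hW.1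
    · simpa using hW.2 r hr
    · simpa [hp] using hpW
    · simpa [hp] using hreach
    · simp [hp]
  · intro i s' hi hf hi' ⟨h1, W', hrow, hsup, hlen, hpos, hne, hcost⟩
    have e0 : s'.nat 0 0 0 = n := by rw [hf.nat 0 (by decide)]; exact h.num_eq
    have e10 : s'.nat 10 0 0 = v := by rw [hf.nat 10 (by decide)]; exact hv
    have e7 : s'.nat 7 = s.nat 7 := hf.nat 7 (by decide)
    obtain ⟨k, hk⟩ : ∃ k, n - i = k + 1 := ⟨n - i - 1, by omega⟩
    have hk' : n - (i + 1) = k := by omega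
    rw [hk] at hne hcost
    set q := s'.nat 15 0 0 with hq
    set x := W'.getVert q with hx
    have hrx : s'.nat 6 v q = x := hrow.2 q hpos
    obtain ⟨hc, -⟩ := ht.cell k (by omega) x x.2
    obtain ⟨y, hyn, h7, hlink, hyne, hdist⟩ := hc.resolve_left hne
    lift y to Fin (n + 1) using hyn
    rw [h.link_iff] at hlink
    refine (Runs.setNat_seq (Runs.cond (T := (L + 1) * 3 + 4 + 1) (fun hb => ?_) fun hb => ?_)).mono
      le_rfl fun _ h => h
    · simp only [Test.Holds, NatExp.eval, e0, e10, e7, hi', hk, ← hq, hrx, h7, State.setNat_nat]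
        at hb
      simp only [Nat.reduceEqDiff, false_and, if_false, and_self, if_true, hrx] at hb
      obtain rfl : y = x := Fin.ext (by omega)
      refine (Runs.skip ?_).mono (by omega) fun _ h => h
      refine ⟨fun v' hv' => ⟨?_, ?_⟩, W', ⟨?_, fun r hr => ?_⟩, hsup, by omega, ?_⟩
      · rw [← (h1 v' hv').1]; funext b; simp
      · rw [← (h1 v' hv').2]; funext b; simp
      · simpa using hrow.1
      · simpa using hrow.2 r hr
      · have e15 : ∀ a b, (((s'.setNat 14 0 0 a).setNat 12 0 0 b).nat 15 0 0) = q := by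
          intro a b; simp [hq]
        simp only [NatExp.eval, e15, hk', ← hx]
        refine ⟨hpos, hyne, ?_⟩
        rw [h.weight_self] at hdist
        linarith
    · simp only [Test.Holds, NatExp.eval, e0, e10, e7, hi', hk, ← hq, hrx, h7, State.setNat_nat]
        at hb
      simp only [Nat.reduceEqDiff, false_and, if_false, and_self, if_true, hrx] at hb
      have hxy : I.graph.Adj x y := hlink.resolve_right fun h => hb (by rw [h]; simp)
      rw [h.weight_eq x y hxy] at hdist
      simp only [NatExp.eval, e0, e10, e7, hi', hk, ← hq, hrx, h7, Nat.add_sub_cancel]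
      obtain ⟨W'', g1, g2, g3, g4, g5⟩ := Instance.exists_insert W' q hpos y hxy
      refine Runs.mono_time (T := (W'.length + 1) * 3 + 4 + 1) (Runs.seq
        (runs_insertVertex _ v q y W'.length (by simpa using e10) (by simp [hq]) (by simp)
          (by simpa using hrow.1) hpos) fun s'' hf'' ⟨f1, f2, f3, f4, f5⟩ => Runs.setNat ?_) ?_
      · have e15 : s''.nat 15 0 0 = q := by rw [hf''.nat 15 (by decide)]; simp [hq]
        simp only [NatExp.eval, e15]
        refine ⟨fun v' hv' => ⟨?_, ?_⟩, W'', ⟨?_, fun r hr => ?_⟩, ?_, by omega, ?_⟩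
        · rw [← (h1 v' hv').1]; funext b; simpa using congrFun (f1 v' hv').1 b
        · rw [← (h1 v' hv').2]; funext b; simpa using congrFun (f1 v' hv').2 b
        · simp [f2, g1]
        · simp only [State.setNat_nat, Nat.reduceEqDiff, false_and, if_false]
          rcases lt_trichotomy r (q + 1) with hr' | rfl | hr'
          · rw [f3 r (by omega), g3 r (by omega)]
            simpa using hrow.2 r (by omega)
          · rw [f4, g4]
          · obtain ⟨r, rfl⟩ : ∃ r', r = r' + 2 := ⟨r - 2, by omega⟩
            rw [f5 r (by omega) (by omega), g5 r (by omega)]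
            simpa using hrow.2 r (by omega)
        · refine List.Subset.trans hsup fun z hz => ?_
          obtain ⟨r, rfl, hr⟩ := SimpleGraph.Walk.mem_support_iff_exists_getVert.1 hz
          rcases le_or_gt q r with hr' | hr'
          · rw [← g5 r hr']; exact W''.getVert_mem_support _
          · rw [← g3 r hr'.le]; exact W''.getVert_mem_support _
        · simp only [State.setNat_nat, Nat.reduceEqDiff, false_and, if_false, and_self, if_true,
            hk', g4, g1, g2]
          refine ⟨by omega, hyne, ?_⟩
          rw [← hx]
          linarith
      · have : (W'.length + 1) * 3 ≤ (L + 1) * 3 := by omega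
        omega
  · rintro s' ⟨h1, W', hrow, hsup, hlen, hpos, hne, hcost⟩
    rw [Nat.sub_self] at hne hcost
    rw [ht.reached_zero _ (Fin.is_lt _)] at hne
    rw [hne, ht.dist_zero] at hcost
    refine ⟨h1, W', hrow, hsup, ?_, hlen, ?_⟩
    · rw [← Fin.ext hne]; exact W'.getVert_mem_support _
    · change I.walkWeight W' ≤ I.walkWeight W + _
      linarith

/-! ## The algorithm -/

namespace Instance

variable (I : Instance)

/-- The binary logarithm of the rounded turnover time. -/
def level (j : Fin I.numClients) : ℕ := Nat.log 2 (I.turnover j)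

/-- The algorithm inserts the client `i` before the client `j`. -/
def Before (i j : Fin I.numClients) : Prop :=
  I.level i < I.level j ∨ I.level i = I.level j ∧ i < j

/-- The weights of the walks to the client `j` from the depot or from an earlier client. -/
def earlierWeights (j : Fin I.numClients) : Set ℝ :=
  {x | ∃ (u : Fin (I.numClients + 1)) (p : I.graph.Walk u j.succ),
    (u = 0 ∨ ∃ i, I.Before i j ∧ u = i.succ) ∧ I.walkWeight p = x}

/-- The distance of the client `j` from the depot and the earlier clients. -/
noncomputable def detour (j : Fin I.numClients) : ℝ := sInf (I.earlierWeights j)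

/-- The clients that are inserted at levels below `v`, or at level `v` and with an index below
`j`. -/
def inserted (v j : ℕ) : Finset (Fin I.numClients) :=
  Finset.univ.filter fun i => I.level i < v ∨ I.level i = v ∧ (i : ℕ) < j

variable {I}

theorem mem_inserted {v j : ℕ} {i : Fin I.numClients} :
    i ∈ I.inserted v j ↔ I.level i < v ∨ I.level i = v ∧ (i : ℕ) < j := by
  simp [inserted]

theorem inserted_numClients (v : ℕ) : I.inserted v I.numClients = I.inserted (v + 1) 0 := by
  ext i
  have := i.2
  simp only [mem_inserted]
  omega

theorem inserted_succ_of_ne {v : ℕ} {j : Fin I.numClients} (h : I.level j ≠ v) :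
    I.inserted v (j + 1) = I.inserted v j := by
  ext i
  simp only [mem_inserted]
  constructor
  · rintro (hi | ⟨hi, hi'⟩)
    · exact .inl hi
    · rcases Nat.lt_succ_iff_lt_or_eq.1 hi' with h' | h'
      · exact .inr ⟨hi, h'⟩
      · exact absurd (Fin.ext h' ▸ hi) h
  · rintro (hi | ⟨hi, hi'⟩)
    · exact .inl hi
    · exact .inr ⟨hi, by omega⟩

theorem inserted_succ (j : Fin I.numClients) :
    I.inserted (I.level j) (j + 1) = insert j (I.inserted (I.level j) j) := by
  ext i
  simp only [mem_inserted, Finset.mem_insert]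
  constructor
  · rintro (hi | ⟨hi, hi'⟩)
    · exact .inr (.inl hi)
    · rcases Nat.lt_succ_iff_lt_or_eq.1 hi' with h' | h'
      · exact .inr (.inr ⟨hi, h'⟩)
      · exact .inl (Fin.ext h')
  · rintro (rfl | hi | ⟨hi, hi'⟩)
    · exact .inr ⟨rfl, by omega⟩
    · exact .inl hi
    · exact .inr ⟨hi, by omega⟩

theorem notMem_inserted (j : Fin I.numClients) : j ∉ I.inserted (I.level j) j := by
  simp [mem_inserted]

theorem detour_le {j : Fin I.numClients} {x : ℝ} (hx : x ∈ I.earlierWeights j) :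
    I.detour j ≤ x := by
  refine csInf_le ⟨0, ?_⟩ hx
  rintro _ ⟨u, p, -, rfl⟩
  exact walkWeight_nonneg p

theorem le_detour {j : Fin I.numClients} {x : ℝ} (h : ∀ y ∈ I.earlierWeights j, x ≤ y) :
    x ≤ I.detour j := by
  obtain ⟨p⟩ := I.connected.preconnected 0 j.succ
  exact le_csInf ⟨_, 0, p, .inl rfl, rfl⟩ h

theorem detour_nonneg (j : Fin I.numClients) : 0 ≤ I.detour j := by
  refine le_detour ?_
  rintro _ ⟨u, p, -, rfl⟩
  exact walkWeight_nonneg p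

end Instance

/-! ### The programs for one client, one level and all levels, with their invariants. -/

/-- Insert the client in register `11` into the current row. -/
def addClient : Program := .seq bellman (.seq select insertPath)

/-- A bound on the number of steps of `addClient` for rows of length at most `L`. -/
def addClientTime (n L : ℕ) : ℕ := bellmanTime n + (((L + 1) * 4 + 3) + insertPathTime n L)

/-- The chosen position of the tour is nearest to `j`, and the tour passes the depot and all earlier
clients, so the distance paid in each direction is at most `detour j`. -/
theorem runs_addClient {I : Instance} {s : State} (h : HoldsInput I s) {j : Fin I.numClients}
    {L : ℕ} (hj : s.nat 11 0 0 = j) (hv : s.nat 10 0 0 = I.level j) {W : I.Tour}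
    (hW : RowOf s (I.level j) W) (hL : W.length + 2 * I.numClients ≤ L)
    (hcov : ∀ i ∈ I.inserted (I.level j) j, i.succ ∈ W.support) :
    Runs addClient s (addClientTime I.numClients L) fun s' =>
      (∀ v' ≠ I.level j, s'.nat 5 v' = s.nat 5 v' ∧ s'.nat 6 v' = s.nat 6 v') ∧
      ∃ W' : I.Tour, RowOf s' (I.level j) W' ∧ W.support ⊆ W'.support ∧ j.succ ∈ W'.support ∧
        W'.length ≤ W.length + 2 * I.numClients ∧
        I.tourLength W' ≤ I.tourLength W + 2 * I.detour j := by
  refine (runs_bellman s I.numClients j h.num_eq hj).seq fun s₁ hf₁ ht => ?_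
  have h₁ : HoldsInput I s₁ := h.frame hf₁ (by decide) (by decide) (by decide) (by decide)
  have hW₁ : RowOf s₁ (I.level j) W := hW.congr (by rw [hf₁.nat 5 (by decide)])
    (by rw [hf₁.nat 6 (by decide)])
  have hv₁ : s₁.nat 10 0 0 = I.level j := by rw [hf₁.nat 10 (by decide), hv]
  refine Runs.mono_time (T := ((W.length + 1) * 4 + 3) + insertPathTime I.numClients L) (Runs.seq
    (runs_select s₁ I.numClients (I.level j) W.length h₁.num_eq hv₁ hW₁.1)
    fun s₂ hf₂ ⟨hp, hmin⟩ => ?_) (by omega)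
  have h₂ : HoldsInput I s₂ := h₁.frame hf₂ (by decide) (by decide) (by decide) (by decide)
  have hW₂ : RowOf s₂ (I.level j) W := hW₁.congr (by rw [hf₂.nat 5 (by decide)])
    (by rw [hf₂.nat 6 (by decide)])
  have e7 : s₂.nat 7 = s₁.nat 7 := hf₂.nat 7 (by decide)
  have e1 : s₂.real 1 = s₁.real 1 := hf₂.real 1 (by decide)
  have ht₂ : Table s₂ I.numClients (j + 1) := by
    refine ⟨?_, ?_, fun k hk x hx => (ht.cell k hk x hx).congr (hf₂.nat 2 (by decide))
      (hf₂.real 0 (by decide)) (by rw [e7]) (by rw [e7]) (by rw [e1]) (by rw [e1])⟩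
    · rw [e7]; exact ht.reached_zero
    · rw [e1]; exact ht.dist_zero
  have hwalk : ∀ {x} (p : I.graph.Walk x j.succ), s₂.nat 7 I.numClients x ≠ 0 ∧
      s₂.real 1 I.numClients x ≤ I.walkWeight p := by
    intro x p
    obtain ⟨q, hq, hqp⟩ := Instance.exists_walk_length_le p
    obtain ⟨a, b⟩ := h₂.table_le (t := j.succ) (by simpa using ht₂) q _ hq le_rfl
    exact ⟨a, b.trans hqp⟩
  -- Equality may fail, since the tour can also pass vertices that are neither the depot nor earlier
  -- clients and lie closer to `j`.
  have hdet : s₂.real 1 I.numClients (W.getVert (s₂.nat 15 0 0)) ≤ I.detour j := by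
    refine Instance.le_detour ?_
    rintro _ ⟨u, p, hu, rfl⟩
    have hmem : u ∈ W.support := by
      rcases hu with rfl | ⟨i, hi, rfl⟩
      · exact W.start_mem_support
      · refine hcov i (Instance.mem_inserted.2 ?_)
        exact hi
    obtain ⟨r, rfl, hr⟩ := SimpleGraph.Walk.mem_support_iff_exists_getVert.1 hmem
    have := hmin r hr
    rw [hW₁.2 _ hp, hW₁.2 _ hr, ← e1] at this
    exact this.trans (hwalk p).2
  obtain ⟨p₀⟩ := I.connected.preconnected (W.getVert (s₂.nat 15 0 0)) j.succ
  refine (runs_insertPath h₂ (t := j.succ) (by simpa using ht₂)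
    (by rw [hf₂.nat 10 (by decide), hv₁]) rfl hW₂ hp hL (hwalk p₀).1).mono le_rfl ?_
  rintro s' ⟨g1, W', g2, g3, g4, g5, g6⟩
  refine ⟨fun v' hv' => ⟨?_, ?_⟩, W', g2, g3, g4, g5, by linarith⟩
  · rw [(g1 v' hv').1, hf₂.nat 5 (by decide), hf₁.nat 5 (by decide)]
  · rw [(g1 v' hv').2, hf₂.nat 6 (by decide), hf₁.nat 6 (by decide)]

/-- Insert all clients of the current level into the current row. -/
def addLevel : Program :=
  .forLoop 11 numExp
    (.cond
      (.and (.natLE (.reg 9) (.get 1 (.reg 11) (.const 0)))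
        (.natLE (.succ (.get 1 (.reg 11) (.const 0))) (.add (.reg 9) (.reg 9))))
      (.seq (.setNat 3 (.reg 11) (.const 0) (.reg 9)) addClient) .skip)

/-- Row `v` of the memory holds the tour `W`, which visits the clients in `A` at the cost of their
detours. -/
structure Serves {I : Instance} (s : State) (v : ℕ) (A : Finset (Fin I.numClients)) (W : I.Tour) :
    Prop where
  row : RowOf s v W
  cover : ∀ i ∈ A, i.succ ∈ W.support
  cost : I.tourLength W ≤ 2 * ∑ i ∈ A, I.detour i

theorem Serves.congr {I : Instance} {s s' : State} {v : ℕ} {A : Finset (Fin I.numClients)}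
    {W : I.Tour} (h : Serves s v A W) (h5 : s'.nat 5 v = s.nat 5 v)
    (h6 : s'.nat 6 v = s.nat 6 v) : Serves s' v A W :=
  ⟨h.row.congr h5 h6, h.cover, h.cost⟩

/-- A bound on the number of steps of `addLevel` for rows of length at most `L`. -/
def addLevelTime (n L : ℕ) : ℕ := n * (addClientTime n L + 1 + 1 + 2) + 2

theorem runs_addLevel {I : Instance} {s : State} (h : HoldsInput I s) {v L : ℕ}
    (hv : s.nat 10 0 0 = v) (h9 : s.nat 9 0 0 = 2 ^ v) {W : I.Tour}
    (hW : Serves s v (I.inserted v 0) W) (hL : W.length + 2 * I.numClients * I.numClients ≤ L)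
    (h3 : ∀ i ∈ I.inserted v 0, s.nat 3 i 0 = 2 ^ I.level i) :
    Runs addLevel s (addLevelTime I.numClients L) fun s' =>
      (∀ v' ≠ v, s'.nat 5 v' = s.nat 5 v' ∧ s'.nat 6 v' = s.nat 6 v') ∧
      (∀ i ∈ I.inserted (v + 1) 0, s'.nat 3 i 0 = 2 ^ I.level i) ∧
      ∃ W' : I.Tour, Serves s' v (I.inserted (v + 1) 0) W' ∧
        W'.length ≤ W.length + 2 * I.numClients * I.numClients := by
  set n := I.numClients with hn
  rw [← Instance.inserted_numClients]
  refine Runs.forLoop (T := addClientTime n L + 1 + 1) n (fun j s' =>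
    (∀ v' ≠ v, s'.nat 5 v' = s.nat 5 v' ∧ s'.nat 6 v' = s.nat 6 v') ∧
      (∀ i ∈ I.inserted v j, s'.nat 3 i 0 = 2 ^ I.level i) ∧
      ∃ W' : I.Tour, Serves s' v (I.inserted v j) W' ∧
        W'.length ≤ W.length + 2 * n * j) (by decide) ?_ ?_ ?_
  · intro s' hf
    simp only [NatExp.eval, hf.nat 0 (by decide)]
    exact h.num_eq
  · refine ⟨fun v' _ => ⟨?_, ?_⟩, fun i hi => by simpa using h3 i hi, W, hW.congr ?_ ?_, by simp⟩
    all_goals funext b; simp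
  · intro j s' hj hf hj' ⟨h1, h2, W', hW', hlen⟩
    lift j to Fin n using hj
    have h' : HoldsInput I s' := h.frame hf (by decide) (by decide) (by decide) (by decide)
    have e10 : s'.nat 10 0 0 = v := by rw [hf.nat 10 (by decide)]; exact hv
    have e9 : s'.nat 9 0 0 = 2 ^ v := by rw [hf.nat 9 (by decide)]; exact h9
    have hset : ∀ (s : State) x, ∀ a ≠ 11, (s.setNat 11 0 0 x).nat a = s.nat a := by
      intro s x a ha; funext i b; simp [ha]
    have hset3 : ∀ (s : State) x y, ∀ a ≠ 3, (s.setNat 3 x 0 y).nat a = s.nat a := by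
      intro s x y a ha; funext i b; simp [ha]
    -- The level is recognised without logarithms or division: register 9 holds `2 ^ v`, and its
    -- double is obtained by addition.
    have htest : (2 ^ v ≤ I.turnover j ∧ I.turnover j + 1 ≤ 2 ^ v + 2 ^ v) ↔ I.level j = v := by
      unfold Instance.level
      rw [Nat.log_eq_iff (.inr ⟨by omega, (I.turnover_pos j).ne'⟩), pow_succ]
      omega
    have hmul : 2 * n * (j + 1) = 2 * n * j + 2 * n := by ring
    refine Runs.cond (fun hb => ?_) fun hb => ?_
    · simp only [Test.Holds, NatExp.eval, hj', e9, h'.turnover_eq, htest] at hb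
      subst hb
      refine Runs.setNat_seq ?_
      simp only [NatExp.eval, hj', e9]
      have hL' : W.length + 2 * n * n ≤ L := hL
      have hjn : 2 * n * (j + 1) ≤ 2 * n * n := Nat.mul_le_mul le_rfl j.2
      refine (runs_addClient (s := s'.setNat 3 j 0 (2 ^ I.level j)) (j := j) (W := W')
        (L := L) ⟨?_, ?_, ?_, h'.weight⟩ ?_ ?_ ?_ ?_ hW'.cover).mono_frame le_rfl ?_
      · rw [hset3 _ _ _ _ (by decide)]; exact h'.num
      · rw [hset3 _ _ _ _ (by decide)]; exact h'.turnover
      · rw [hset3 _ _ _ _ (by decide)]; exact h'.adj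
      · rw [hset3 _ _ _ _ (by decide)]; exact hj'
      · rw [hset3 _ _ _ _ (by decide)]; exact e10
      · exact hW'.row.congr (by rw [hset3 _ _ _ _ (by decide)])
          (by rw [hset3 _ _ _ _ (by decide)])
      · omega
      · rintro s'' hf'' ⟨g1, W'', g2, g3, g4, g5, g6⟩
        refine ⟨fun v' hv' => ?_, fun i hi => ?_, W'', ⟨?_, fun i hi => ?_, ?_⟩, by omega⟩
        · rw [hset _ _ _ (by decide), hset _ _ _ (by decide), (g1 v' hv').1, (g1 v' hv').2,
            hset3 _ _ _ _ (by decide), hset3 _ _ _ _ (by decide)]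
          exact h1 v' hv'
        · rw [hset _ _ _ (by decide), hf''.nat 3 (by decide)]
          rw [Instance.inserted_succ, Finset.mem_insert] at hi
          by_cases hij : i = j
          · simp [hij]
          · have : (i : ℕ) ≠ j := fun h => hij (Fin.ext h)
            simpa [this] using h2 i (hi.resolve_left hij)
        · exact g2.congr (by rw [hset _ _ _ (by decide)]) (by rw [hset _ _ _ (by decide)])
        · rw [Instance.inserted_succ, Finset.mem_insert] at hi
          rcases hi with rfl | hi
          · exact g4
          · exact g3 (hW'.cover i hi)
        · rw [Instance.inserted_succ, Finset.sum_insert (Instance.notMem_inserted j)]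
          have := hW'.cost
          linarith
    · simp only [Test.Holds, NatExp.eval, hj', e9, h'.turnover_eq, htest] at hb
      refine Runs.mono_time (T := 1) (Runs.skip ?_) (by omega)
      rw [Instance.inserted_succ_of_ne hb, hset _ _ _ (by decide), hset _ _ _ (by decide),
        hset _ _ _ (by decide)]
      exact ⟨h1, h2, W', hW'.congr (by rw [hset _ _ _ (by decide)])
        (by rw [hset _ _ _ (by decide)]), by omega⟩

/-- The sum of the turnover times, an upper bound on the rounded turnover times. -/
def sumTurnover : Program :=
  .forLoop 11 numExp
    (.setNat 8 (.const 0) (.const 0) (.add (.reg 8) (.get 1 (.reg 11) (.const 0))))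

/-- One level of the algorithm. -/
def oneLevel : Program :=
  .seq addLevel (.seq copyRow
    (.seq (.setNat 10 (.const 0) (.const 0) (.succ (.reg 10)))
      (.setNat 9 (.const 0) (.const 0) (.add (.reg 9) (.reg 9)))))

/-- The approximation algorithm. -/
def approx : Program :=
  .seq sumTurnover (.seq (.setNat 9 (.const 0) (.const 0) (.const 1))
    (.seq (.loop (.natLE (.reg 9) (.reg 8)) oneLevel)
      (.setNat 4 (.const 0) (.const 0) (.reg 10))))

/-- A bound on the number of steps of `oneLevel` for rows of length at most `L`. -/
def oneLevelTime (n L : ℕ) : ℕ := addLevelTime n L + ((L + 1) * 3 + 3 + 2)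

/-- The state at the beginning of level `v`. -/
structure AtLevel (I : Instance) (v : ℕ) (s : State) : Prop where
  input : HoldsInput I s
  sum : s.nat 8 0 0 = ∑ j, I.turnover j
  power : s.nat 9 0 0 = 2 ^ v
  level : s.nat 10 0 0 = v
  number : ∀ i ∈ I.inserted v 0, s.nat 3 i 0 = 2 ^ I.level i
  old : ∀ v' < v, ∃ W : I.Tour, Serves s v' (I.inserted (v' + 1) 0) W
  current : ∃ W : I.Tour, Serves s v (I.inserted v 0) W ∧
    W.length ≤ v * (2 * I.numClients * I.numClients)

/-- Row `v` is completed and then copied as the starting tour of row `v + 1`. Each level makes at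
most `n` insertions of at most `2 * n` edges, so row lengths grow only linearly in `v`. -/
theorem runs_oneLevel {I : Instance} {s : State} {v N : ℕ} (h : AtLevel I v s) (hv : v < N) :
    Runs oneLevel s (oneLevelTime I.numClients (N * (2 * I.numClients * I.numClients)))
      (AtLevel I (v + 1)) := by
  obtain ⟨W, hW, hlen⟩ := h.current
  set L := N * (2 * I.numClients * I.numClients)
  have hL : (v + 1) * (2 * I.numClients * I.numClients) ≤ L := Nat.mul_le_mul hv le_rfl
  rw [Nat.succ_mul] at hL
  refine (runs_addLevel h.input h.level h.power hW (L := L) (by omega) h.number).seq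
    fun s₁ hf₁ ⟨f1, f2, W', f3, f4⟩ => ?_
  have e10 : s₁.nat 10 0 0 = v := by rw [hf₁.nat 10 (by decide)]; exact h.level
  have e9 : s₁.nat 9 0 0 = 2 ^ v := by rw [hf₁.nat 9 (by decide)]; exact h.power
  refine Runs.mono_time (T := (W'.length + 1) * 3 + 3 + (1 + 1)) (Runs.seq
    (runs_copyRow s₁ v W'.length e10 f3.row.1) fun s₂ hf₂ ⟨g1, g2, g3⟩ =>
      Runs.setNat_seq (Runs.setNat ?_)) (by omega)
  have e10' : s₂.nat 10 0 0 = v := by rw [hf₂.nat 10 (by decide)]; exact e10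
  have e9' : s₂.nat 9 0 0 = 2 ^ v := by rw [hf₂.nat 9 (by decide)]; exact e9
  have hset : ∀ x y a, a ≠ 10 → a ≠ 9 → ((s₂.setNat 10 0 0 x).setNat 9 0 0 y).nat a = s₂.nat a := by
    intro x y a ha ha'; funext i b; simp [ha, ha']
  have hin : HoldsInput I s₂ :=
    (h.input.frame hf₁ (by decide) (by decide) (by decide) (by decide)).frame hf₂
      (by decide) (by decide) (by decide) (by decide)
  have hcur : Serves s₂ v (I.inserted (v + 1) 0) W' :=
    f3.congr (g1 v (by omega)).1 (g1 v (by omega)).2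
  simp only [NatExp.eval]
  refine ⟨⟨?_, ?_, ?_, hin.weight⟩, ?_, ?_, ?_, fun i hi => ?_, fun v' hv' => ?_, W', ⟨⟨?_, ?_⟩,
    f3.cover, f3.cost⟩, by rw [Nat.succ_mul]; omega⟩
  · rw [hset _ _ _ (by decide) (by decide)]; exact hin.num
  · rw [hset _ _ _ (by decide) (by decide)]; exact hin.turnover
  · rw [hset _ _ _ (by decide) (by decide)]; exact hin.adj
  · rw [hset _ _ _ (by decide) (by decide), hf₂.nat 8 (by decide), hf₁.nat 8 (by decide)]
    exact h.sum
  · simp [e9', pow_succ, mul_two]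
  · simp [e10']
  · rw [hset _ _ _ (by decide) (by decide), hf₂.nat 3 (by decide)]
    exact f2 i hi
  · rcases Nat.lt_succ_iff_lt_or_eq.1 hv' with hlt | rfl
    · obtain ⟨U, hU⟩ := h.old v' hlt
      refine ⟨U, hU.congr ?_ ?_⟩
      · rw [hset _ _ _ (by decide) (by decide), (g1 v' (by omega)).1, (f1 v' (by omega)).1]
      · rw [hset _ _ _ (by decide) (by decide), (g1 v' (by omega)).2, (f1 v' (by omega)).2]
    · exact ⟨W', hcur.congr (by rw [hset _ _ _ (by decide) (by decide)])
        (by rw [hset _ _ _ (by decide) (by decide)])⟩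
  · rw [hset _ _ _ (by decide) (by decide)]; exact g2
  · intro r hr
    rw [hset _ _ _ (by decide) (by decide), g3 r hr]
    exact f3.row.2 r hr

/-- The output of the algorithm, with `m + 1` tours. -/
structure Output (I : Instance) (m : ℕ) (s : State) : Prop where
  count : s.nat 4 0 0 = m
  level_lt : ∀ j, I.level j < m
  number : ∀ j : Fin I.numClients, s.nat 3 j 0 = 2 ^ I.level j
  row : ∀ v ≤ m, ∃ W : I.Tour, Serves s v (I.inserted (v + 1) 0) W

/-- A bound on the number of steps of `approx`. -/
def approxTime (n N : ℕ) : ℕ :=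
  n * 3 + 2 + (N * (oneLevelTime n (N * (2 * n * n)) + 1) + 1 + 1 + 1)

/-- The loop stops once `2 ^ m` exceeds the sum of the turnover times, which happens for some `m ≤
N` and forces every level below `m`. -/
theorem runs_approx (I : Instance) (N : ℕ) (hN : ∑ j, I.turnover j < 2 ^ N) :
    Runs approx I.input (approxTime I.numClients N) fun s => ∃ m, Output I m s := by
  have h₀ : HoldsInput I I.input := ⟨rfl, rfl, rfl, rfl⟩
  unfold approx approxTime
  refine Runs.seq (R := fun s' => s'.nat 8 0 0 = ∑ j, I.turnover j) (Runs.mono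
    (Runs.forLoop (T := 1) I.numClients
      (fun j s' => s'.nat 8 0 0 = ∑ i ∈ Finset.univ.filter (fun i : Fin I.numClients => i < j),
        I.turnover i) (by decide) ?_ ?_ ?_) le_rfl ?_) fun s₁ hf₁ hsum => ?_
  · intro s' hf
    simp only [NatExp.eval, hf.nat 0 (by decide)]
    exact h₀.num_eq
  · simp [Instance.input]
  · intro j s' hj hf hj' hs
    lift j to Fin I.numClients using hj
    have h' : HoldsInput I s' := h₀.frame hf (by decide) (by decide) (by decide) (by decide)
    refine Runs.setNat ?_
    have : (Finset.univ.filter fun i : Fin I.numClients => (i : ℕ) < j + 1) =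
        insert j (Finset.univ.filter fun i : Fin I.numClients => (i : ℕ) < j) := by
      ext i
      simp only [Finset.mem_filter, Finset.mem_univ, true_and, Finset.mem_insert, Fin.ext_iff]
      omega
    simp only [NatExp.eval, State.setNat_nat, Nat.reduceEqDiff, false_and, if_false, and_self,
      if_true, hj', h'.turnover_eq, hs]
    rw [this, Finset.sum_insert (by simp), add_comm]
  · intro s' hs
    rw [hs]
    congr 1
    ext i
    simp
  have h₁ : HoldsInput I s₁ := h₀.frame hf₁ (by decide) (by decide) (by decide) (by decide)
  refine Runs.setNat_seq ?_
  simp only [NatExp.eval]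
  have hset : ∀ a, a ≠ 9 → (s₁.setNat 9 0 0 1).nat a = s₁.nat a := by
    intro a ha; funext i b; simp [ha]
  -- Zero-initialised memory already describes the trivial tour in row `0`: length `0`, at vertex
  -- `0`, the depot.
  have hstart : AtLevel I 0 (s₁.setNat 9 0 0 1) := by
    refine ⟨⟨?_, ?_, ?_, h₁.weight⟩, ?_, by simp, ?_, by simp [Instance.mem_inserted], by simp,
      .nil, ⟨⟨?_, fun r hr => ?_⟩, by simp [Instance.mem_inserted], ?_⟩, by simp⟩
    · rw [hset _ (by decide)]; exact h₁.num
    · rw [hset _ (by decide)]; exact h₁.turnover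
    · rw [hset _ (by decide)]; exact h₁.adj
    · rw [hset _ (by decide)]; exact hsum
    · rw [hset _ (by decide), hf₁.nat 10 (by decide)]; simp [Instance.input]
    · rw [hset _ (by decide), hf₁.nat 5 (by decide)]; simp [Instance.input]
    · rw [hset _ (by decide), hf₁.nat 6 (by decide)]
      obtain rfl : r = 0 := by simpa using hr
      simp [Instance.input]
    · refine (show I.tourLength .nil = 0 by simp [Instance.tourLength]).trans_le ?_
      exact mul_nonneg zero_le_two (Finset.sum_nonneg fun i _ => Instance.detour_nonneg i)
  have hloop := Runs.loop (b := .natLE (.reg 9) (.reg 8)) (P := oneLevel)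
    (T := oneLevelTime I.numClients (N * (2 * I.numClients * I.numClients))) (AtLevel I) N
    (fun v s' h hb => by
      simp only [Test.Holds, NatExp.eval, h.power, h.sum] at hb
      have hv : v < N := (Nat.pow_lt_pow_iff_right (by norm_num)).1 (hb.trans_lt hN)
      exact ⟨hv, runs_oneLevel h hv⟩) 0 _ (Nat.zero_le _) hstart
  rw [Nat.sub_zero] at hloop
  refine hloop.seq fun s₂ hf₂ ⟨m, hm, h, hb⟩ => Runs.setNat ?_
  simp only [Test.Holds, NatExp.eval, h.power, h.sum, not_le] at hb
  have hlev : ∀ j, I.level j < m := by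
    intro j
    have h1 : 2 ^ I.level j ≤ I.turnover j := Nat.pow_log_le_self 2 (I.turnover_pos j).ne'
    have h2 : I.turnover j ≤ ∑ j, I.turnover j :=
      Finset.single_le_sum (f := I.turnover) (fun _ _ => Nat.zero_le _) (Finset.mem_univ j)
    exact (Nat.pow_lt_pow_iff_right (by norm_num)).1 (h1.trans_lt (h2.trans_lt hb))
  have hset : ∀ x a, a ≠ 4 → (s₂.setNat 4 0 0 x).nat a = s₂.nat a := by
    intro x a ha; funext i b; simp [ha]
  simp only [NatExp.eval, h.level]
  refine ⟨m, by simp, hlev, fun j => ?_, fun v hv => ?_⟩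
  · rw [hset _ _ (by decide)]
    exact h.number j (Instance.mem_inserted.2 (.inl (hlev j)))
  · have : ∃ W : I.Tour, Serves s₂ v (I.inserted (v + 1) 0) W := by
      rcases hv.lt_or_eq with hv | rfl
      · exact h.old v hv
      · obtain ⟨W, hW, -⟩ := h.current
        -- The last row was copied but not processed; this is no loss, since no client has level
        -- `m`.
        have : I.inserted v 0 = I.inserted (v + 1) 0 := by
          ext i
          have := hlev i
          simp only [Instance.mem_inserted]
          omega
        exact ⟨W, this ▸ hW⟩
    obtain ⟨W, hW⟩ := this
    exact ⟨W, hW.congr (by rw [hset _ _ (by decide)]) (by rw [hset _ _ (by decide)])⟩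

/-! ## The lower bound -/

namespace Instance

variable {I : Instance}

/-- A walk to the depot that visits separated vertices is long. -/
theorem add_two_mul_sum_le {M : Set (Fin (I.numClients + 1))} {ρ : Fin (I.numClients + 1) → ℝ}
    (h0 : 0 ∈ M) (hρ : ρ 0 = 0)
    (hsep : ∀ u ∈ M, ∀ v ∈ M, u ≠ v → ∀ p : I.graph.Walk u v, ρ u + ρ v ≤ I.walkWeight p)
    {x y : Fin (I.numClients + 1)} (p : I.graph.Walk x y) (hy : y = 0) :
    ∀ u ∈ M, ∀ (q : I.graph.Walk u x) (A : Finset (Fin (I.numClients + 1))),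
      (∀ a ∈ A, a ∈ M ∧ a ∈ p.support) → u ∉ A → 0 ∉ A →
      ρ u + 2 * ∑ a ∈ A, ρ a ≤ I.walkWeight q + I.walkWeight p := by
  -- Here `u` is the last separated vertex that has been met, `q` is the walk since then, and `A`
  -- contains the separated vertices still to be collected on `p`.
  induction p with
  | nil =>
    subst hy
    intro u hu q A hA _ h0A
    have : A = ∅ := Finset.eq_empty_of_forall_notMem fun a ha => by
      have := (hA a ha).2
      simp only [SimpleGraph.Walk.support_nil, List.mem_singleton] at this
      exact h0A (this ▸ ha)
    subst this
    by_cases hu0 : u = 0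
    · have := walkWeight_nonneg q
      simpa [hu0, hρ]
    · have := hsep u hu 0 h0 hu0 q
      simpa [hρ] using this
  | @cons x z y hxz p ih =>
    intro u hu q A hA huA h0A
    -- If `x` is to be collected, the leg `q` from `u` to `x` is complete and pays `ρ u + ρ x`; a
    -- new leg starts at `x`. Each vertex of `A` is thus paid for twice, at the end of one leg and
    -- at the start of the next.
    by_cases hx : x ∈ A
    · have h1 := hsep u hu x (hA x hx).1 (fun h => huA (h ▸ hx)) q
      have h2 := ih hy x (hA x hx).1 (.cons hxz .nil) (A.erase x) (fun a ha => by
        obtain ⟨hne, ha⟩ := Finset.mem_erase.1 ha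
        obtain ⟨h3, h4⟩ := hA a ha
        rw [SimpleGraph.Walk.support_cons, List.mem_cons] at h4
        exact ⟨h3, h4.resolve_left hne⟩) (by simp) (fun h => h0A (Finset.mem_of_mem_erase h))
      have h3 := Finset.add_sum_erase A ρ hx
      rw [walkWeight_cons] at h2 ⊢
      rw [walkWeight_nil] at h2
      linarith
    · have h2 := ih hy u hu (q.append (.cons hxz .nil)) A (fun a ha => by
        obtain ⟨h3, h4⟩ := hA a ha
        rw [SimpleGraph.Walk.support_cons, List.mem_cons] at h4
        exact ⟨h3, h4.resolve_left fun h => hx (h ▸ ha)⟩) huA h0A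
      rw [walkWeight_append, walkWeight_cons, walkWeight_nil] at h2
      rw [walkWeight_cons]
      linarith

/-- A tour that visits separated clients is long. -/
theorem two_mul_sum_le_tourLength {K : Finset (Fin I.numClients)} {r : Fin I.numClients → ℝ}
    (hsep : ∀ i ∈ K, ∀ j ∈ K, i ≠ j → ∀ p : I.graph.Walk i.succ j.succ,
      r i + r j ≤ I.walkWeight p)
    (hsep0 : ∀ j ∈ K, ∀ p : I.graph.Walk 0 j.succ, r j ≤ I.walkWeight p) (T : I.Tour) :
    2 * ∑ j ∈ K with j.succ ∈ T.support, r j ≤ I.tourLength T := by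
  set ρ : Fin (I.numClients + 1) → ℝ := Fin.cases 0 r with hρ
  have := add_two_mul_sum_le (M := {x | x = 0 ∨ ∃ j ∈ K, x = j.succ}) (ρ := ρ) (.inl rfl) rfl ?_ T
    rfl 0 (.inl rfl) .nil ((K.filter fun j => j.succ ∈ T.support).map (Fin.succEmb _)) ?_ ?_ ?_
  · rw [Finset.sum_map] at this
    simpa [hρ, tourLength, walkWeight] using this
  · rintro u (rfl | ⟨i, hi, rfl⟩) v (rfl | ⟨j, hj, rfl⟩) huv p
    · exact absurd rfl huv
    · simpa [hρ] using hsep0 j hj p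
    · simpa [hρ, walkWeight_reverse] using hsep0 i hi p.reverse
    · exact hsep i hi j hj (fun h => huv (h ▸ rfl)) p
  · intro a ha
    obtain ⟨j, hj, rfl⟩ := Finset.mem_map.1 ha
    obtain ⟨h1, h2⟩ := Finset.mem_filter.1 hj
    exact ⟨.inr ⟨j, h1, rfl⟩, h2⟩
  · simp [Fin.succ_ne_zero]
  · simp [Fin.succ_ne_zero]

theorem pow_level_le (j : Fin I.numClients) : 2 ^ I.level j ≤ I.turnover j :=
  Nat.pow_log_le_self 2 (I.turnover_pos j).ne'

theorem turnover_lt (j : Fin I.numClients) : I.turnover j < 2 * 2 ^ I.level j := by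
  rw [← pow_succ']
  exact Nat.lt_pow_succ_log_self one_lt_two _

theorem tourLength_nonneg (T : I.Tour) : 0 ≤ I.tourLength T := walkWeight_nonneg T

end Instance

/-! ### Frequency of visits and averaging over a period. -/

theorem sum_range_mul {M : Type*} [AddCommMonoid M] (f : ℕ → M) (a b : ℕ) :
    ∑ k ∈ Finset.range (a * b), f k =
      ∑ i ∈ Finset.range a, ∑ r ∈ Finset.range b, f (i * b + r) := by
  induction a with
  | zero => simp
  | succ a ih => rw [Nat.succ_mul, Finset.sum_range_add, ih, Finset.sum_range_succ]

namespace Solution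

variable {I : Instance}

theorem avgLength_nonneg (S : Solution I) : 0 ≤ S.avgLength :=
  div_nonneg (Finset.sum_nonneg fun _ _ => Instance.tourLength_nonneg _) (Nat.cast_nonneg _)

theorem tour_add_mul_period (S : Solution I) (k i : ℕ) (hk : 1 ≤ k) :
    S.tour (k + i * S.period) = S.tour k := by
  induction i with
  | zero => simp
  | succ i ih =>
    rw [Nat.succ_mul, ← Nat.add_assoc, S.tour_add_period _ (by omega), ih]

/-- In a feasible solution each client lies on sufficiently many tours of a period. -/
theorem Feasible.period_le {S : Solution I} (hS : S.Feasible) (j : Fin I.numClients) :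
    S.period ≤
      I.turnover j * ((Finset.Icc 1 S.period).filter fun k => j.succ ∈ (S.tour k).support).card := by
  classical
  set f : ℕ → ℕ := fun k => if j.succ ∈ (S.tour (k + 1)).support then 1 else 0 with hf
  have hcard : ((Finset.Icc 1 S.period).filter fun k => j.succ ∈ (S.tour k).support).card =
      ∑ k ∈ Finset.range S.period, f k := by
    rw [Finset.card_filter, Finset.range_eq_Ico,
      Finset.sum_Ico_add' (fun k => if j.succ ∈ (S.tour k).support then 1 else 0)]
    rfl
  -- The days `1, …, τ_j * period` are counted in two ways: as `τ_j` periods with equally many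
  -- visits, and as `period` windows of `τ_j` days with at least one visit each.
  have h1 : ∑ k ∈ Finset.range (I.turnover j * S.period), f k =
      I.turnover j * ∑ k ∈ Finset.range S.period, f k := by
    rw [sum_range_mul]
    have : ∀ i r, f (i * S.period + r) = f r := by
      intro i r
      simp only [hf]
      rw [show i * S.period + r + 1 = (r + 1) + i * S.period by ring,
        S.tour_add_mul_period _ _ (by omega)]
    simp [this]
  have h2 : S.period ≤ ∑ k ∈ Finset.range (S.period * I.turnover j), f k := by
    rw [sum_range_mul]
    calc S.period = ∑ _i ∈ Finset.range S.period, 1 := by simp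
      _ ≤ _ := Finset.sum_le_sum fun i _ => ?_
    obtain ⟨k, hk, hv⟩ := hS (i * I.turnover j) j
    rw [Finset.mem_Icc] at hk
    obtain ⟨r, rfl⟩ : ∃ r, k = i * I.turnover j + r + 1 := ⟨k - (i * I.turnover j + 1), by omega⟩
    have hfr : f (i * I.turnover j + r) = 1 := by
      simp [hf, S.mem_support _ (by omega) _ hv]
    rw [← hfr]
    exact Finset.single_le_sum (f := fun r => f (i * I.turnover j + r)) (fun _ _ => Nat.zero_le _)
      (Finset.mem_range.2 (by omega))
  rw [hcard, ← h1, mul_comm]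
  exact h2

/-- The lower bound for clients whose detours are long compared to their turnover times. -/
theorem Feasible.card_mul_le {S : Solution I} (hS : S.Feasible) (K : Finset (Fin I.numClients))
    (α : ℝ) (hα : ∀ j ∈ K, α ≤ I.detour j / 2 ^ I.level j) :
    K.card * α ≤ 2 * S.avgLength := by
  rcases le_or_gt α 0 with hα0 | hα0
  · have := S.avgLength_nonneg
    have := mul_nonpos_of_nonneg_of_nonpos (Nat.cast_nonneg (α := ℝ) K.card) hα0
    linarith
  have hdet : ∀ j ∈ K, α * 2 ^ I.level j ≤ I.detour j := fun j hj =>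
    (le_div_iff₀ (by positivity)).1 (hα j hj)
  -- Half of the guaranteed detour. For `i` before `j` both radii are at most `α * 2 ^ level j / 2`,
  -- so their sum is at most `detour j`.
  set r : Fin I.numClients → ℝ := fun j => α * 2 ^ I.level j / 2 with hr
  have hbefore : ∀ i j, j ∈ K → I.Before i j → ∀ p : I.graph.Walk i.succ j.succ,
      r i + r j ≤ I.walkWeight p := by
    intro i j hj hij p
    have h1 := hdet j hj
    have h2 : I.detour j ≤ I.walkWeight p :=
      Instance.detour_le ⟨_, p, .inr ⟨i, hij, rfl⟩, rfl⟩
    have h3 : I.level i ≤ I.level j := by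
      rcases hij with h | h
      · exact h.le
      · exact h.1.le
    have h4 : α * 2 ^ I.level i ≤ α * 2 ^ I.level j := by gcongr; norm_num
    simp only [hr]
    linarith
  have htour : ∀ T : I.Tour, 2 * ∑ j ∈ K with j.succ ∈ T.support, r j ≤ I.tourLength T := by
    refine Instance.two_mul_sum_le_tourLength ?_ ?_
    · intro i hi j hj hij p
      have : I.Before i j ∨ I.Before j i := by
        unfold Instance.Before
        have : i < j ∨ j < i := lt_or_gt_of_ne hij
        omega
      rcases this with h | h
      · exact hbefore i j hj h p
      · rw [add_comm, ← Instance.walkWeight_reverse]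
        exact hbefore j i hi h p.reverse
    · intro j hj p
      have h1 := hdet j hj
      have h2 : I.detour j ≤ I.walkWeight p := Instance.detour_le ⟨_, p, .inl rfl, rfl⟩
      have h3 : 0 < α * 2 ^ I.level j := by positivity
      simp only [hr]
      linarith
  have hℓ : (0 : ℝ) < S.period := by exact_mod_cast S.period_pos
  rw [avgLength, mul_div_assoc', le_div_iff₀ hℓ]
  -- Double counting of pairs of a client in `K` and a day whose tour passes it. The outer factor
  -- `2` is the loss from `τ_j < 2 * 2 ^ level j`.
  calc K.card * α * S.period = ∑ _j ∈ K, α * S.period := by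
        rw [Finset.sum_const, nsmul_eq_mul]; ring
    _ ≤ ∑ j ∈ K, 2 * (2 * r j *
        ((Finset.Icc 1 S.period).filter fun k => j.succ ∈ (S.tour k).support).card) := by
      refine Finset.sum_le_sum fun j _ => ?_
      have h1 : (S.period : ℝ) ≤ I.turnover j *
          ((Finset.Icc 1 S.period).filter fun k => j.succ ∈ (S.tour k).support).card := by
        exact_mod_cast hS.period_le j
      have h2 : (I.turnover j : ℝ) ≤ 2 * 2 ^ I.level j := by
        exact_mod_cast (Instance.turnover_lt j).le
      set a : ℝ :=
        Nat.cast ((Finset.Icc 1 S.period).filter fun k => j.succ ∈ (S.tour k).support).card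
      calc α * S.period ≤ α * (I.turnover j * a) := by gcongr
        _ ≤ α * (2 * 2 ^ I.level j * a) := by
          have : 0 ≤ a := Nat.cast_nonneg _
          gcongr
        _ = _ := by simp only [hr]; ring
    _ = 2 * ∑ k ∈ Finset.Icc 1 S.period, 2 * ∑ j ∈ K with j.succ ∈ (S.tour k).support, r j := by
      rw [← Finset.mul_sum]
      congr 1
      simp_rw [Finset.card_filter, Finset.sum_filter, Nat.cast_sum, Finset.mul_sum]
      rw [Finset.sum_comm]
      refine Finset.sum_congr rfl fun k _ => Finset.sum_congr rfl fun j _ => ?_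
      split_ifs <;> simp
    _ ≤ 2 * ∑ k ∈ Finset.Icc 1 S.period, I.tourLength (S.tour k) := by
      gcongr with k
      exact htour _

end Solution

/-- Taking `K = s` and `α` the minimum shows that the smallest value is at most `B / |s|`. Removing
it and repeating yields `B` times the sum of the reciprocals. -/
theorem sum_le_harmonic_mul {ι : Type*} (s : Finset ι) (a : ι → ℝ) (B : ℝ)
    (h : ∀ K ⊆ s, ∀ α : ℝ, (∀ j ∈ K, α ≤ a j) → K.card * α ≤ B) :
    ∑ j ∈ s, a j ≤ harmonic s.card * B := by
  classical
  induction hn : s.card generalizing s with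
  | zero => simp [Finset.card_eq_zero.1 hn]
  | succ n ih =>
    obtain ⟨j, hj, hmin⟩ := s.exists_min_image a (Finset.card_pos.1 (by omega))
    have h1 := ih (s.erase j) (fun K hK => h K (hK.trans (Finset.erase_subset _ _)))
      (by rw [Finset.card_erase_of_mem hj, hn]; rfl)
    have h2 := h s subset_rfl (a j) hmin
    rw [hn] at h2
    have h3 : a j ≤ ((n + 1 : ℕ) : ℝ)⁻¹ * B := by
      rw [inv_mul_eq_div, le_div_iff₀ (by positivity)]
      linarith
    rw [← Finset.add_sum_erase s a hj, harmonic_succ, Rat.cast_add, add_mul]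
    push_cast at h3 ⊢
    linarith

/-- The lower bound on the cost of a feasible solution. -/
theorem Solution.Feasible.sum_detour_le {I : Instance} {S : Solution I} (hS : S.Feasible) :
    ∑ j, I.detour j / 2 ^ I.level j ≤ harmonic I.numClients * (2 * S.avgLength) := by
  have := sum_le_harmonic_mul Finset.univ (fun j => I.detour j / 2 ^ I.level j)
    (2 * S.avgLength) fun K _ α h => hS.card_mul_le K α h
  simpa using this

/-- The additive constant in `1 + log n` is absorbed by `log (n + 1) ≥ log 2`. Without clients both
sides vanish, so the bound covers the one-vertex graph. -/
theorem harmonic_le_log (n : ℕ) :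
    (harmonic n : ℝ) ≤ (1 / Real.log 2 + 1) * Real.log (n + 1 : ℕ) := by
  rcases Nat.eq_zero_or_pos n with rfl | hn
  · simp
  · have h2 : 0 < Real.log 2 := Real.log_pos one_lt_two
    have hn' : (1 : ℝ) ≤ n := by exact_mod_cast hn
    have h1 : Real.log 2 ≤ Real.log (n + 1 : ℕ) :=
      Real.log_le_log two_pos (by push_cast; linarith)
    have h3 : Real.log n ≤ Real.log (n + 1 : ℕ) :=
      Real.log_le_log (by linarith) (by push_cast; linarith)
    have h4 : 1 ≤ 1 / Real.log 2 * Real.log (n + 1 : ℕ) := by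
      rw [one_div_mul_eq_div, one_le_div h2]
      exact h1
    have := harmonic_le_one_add_log n
    linarith

/-! ## The solution of the algorithm -/

/-- For `i ≤ m`, adding `2 ^ m` does not affect divisibility by `2 ^ i`. This makes `2 ^ m` a period
of the tours. -/
theorem min_padicValNat_add_pow (k m : ℕ) (hk : 1 ≤ k) :
    min (padicValNat 2 (k + 2 ^ m)) m = min (padicValNat 2 k) m := by
  refine eq_of_forall_le_iff fun i => ?_
  rw [le_min_iff, le_min_iff, ← padicValNat_dvd_iff_le (by positivity),
    ← padicValNat_dvd_iff_le (by omega)]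
  refine and_congr_left fun hi => ?_
  exact Nat.dvd_add_left (pow_dvd_pow 2 hi)

namespace Output

variable {I : Instance} {m : ℕ} {s : State}

/-- All levels are below `m`, so capping the valuation at `m` loses no client: the row of day `k`
serves exactly the clients due on that day. -/
theorem mem_inserted_iff (h : Output I m s) {k : ℕ} (hk : 1 ≤ k) (j : Fin I.numClients) :
    j ∈ I.inserted (min (padicValNat 2 k) m + 1) 0 ↔ 2 ^ I.level j ∣ k := by
  have := h.level_lt j
  rw [Instance.mem_inserted, padicValNat_dvd_iff_le (by omega)]
  omega

/-- The solution that is described by the output. -/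
theorem exists_solution (h : Output I m s) : ∃ S : Solution I,
    S.IsDescribedBy s ∧ S.IsSynchronized ∧ S.Feasible ∧
      S.avgLength ≤ 2 * ∑ j, I.detour j / 2 ^ I.level j := by
  have : Nonempty I.Tour := ⟨.nil⟩
  choose! W hW using h.row
  have hW' : ∀ k, Serves s (min (padicValNat 2 k) m) (I.inserted (min (padicValNat 2 k) m + 1) 0)
      (W (min (padicValNat 2 k) m)) := fun k => hW _ (min_le_right _ _)
  let S : Solution I :=
    { tour := fun k => W (min (padicValNat 2 k) m)
      visited := fun k => Finset.univ.filter fun j => 2 ^ I.level j ∣ k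
      mem_support := fun k hk j hj =>
        (hW' k).cover j ((h.mem_inserted_iff hk j).2 (Finset.mem_filter.1 hj).2)
      period := 2 ^ m
      period_pos := by positivity
      tour_add_period := fun k hk => by rw [min_padicValNat_add_pow k m hk] }
  have hvis : ∀ k j, j ∈ S.visited k ↔ 2 ^ I.level j ∣ k := fun k j => by simp [S]
  refine ⟨S, fun k hk => ⟨fun j => ?_, ?_, ?_⟩, fun k _ j => hvis k j, fun t j => ?_, ?_⟩
  · rw [hvis, h.number]
  · rw [h.count]
    exact (hW' k).row.1
  · rw [h.count]
    exact (hW' k).row.2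
  · have h1 := Instance.pow_level_le j
    have h2 : 0 < 2 ^ I.level j := by positivity
    -- The first multiple of `2 ^ level j` after `t` comes within `2 ^ level j ≤ τ_j` days.
    refine ⟨2 ^ I.level j * (t / 2 ^ I.level j + 1), ?_, (hvis _ _).2 (dvd_mul_right _ _)⟩
    have h3 := Nat.div_add_mod t (2 ^ I.level j)
    have h4 := Nat.mod_lt t h2
    rw [Finset.mem_Icc, mul_add, mul_one]
    omega
  · have hp : ((2 ^ m : ℕ) : ℝ) = 2 ^ m := by push_cast; rfl
    change (∑ k ∈ Finset.Icc 1 (2 ^ m), I.tourLength (W (min (padicValNat 2 k) m))) /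
      ((2 ^ m : ℕ) : ℝ) ≤ _
    rw [hp, div_le_iff₀ (by positivity)]
    calc ∑ k ∈ Finset.Icc 1 (2 ^ m), I.tourLength (W (min (padicValNat 2 k) m))
        ≤ ∑ k ∈ Finset.Icc 1 (2 ^ m), 2 * ∑ j, if 2 ^ I.level j ∣ k then I.detour j else 0 := by
          refine Finset.sum_le_sum fun k hk => (hW' k).cost.trans_eq ?_
          rw [← Finset.sum_filter]
          congr 2
          ext j
          rw [h.mem_inserted_iff (Finset.mem_Icc.1 hk).1]
          simp
      -- Exchanging the sums charges each client for the days of the period on which it is due.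
      _ = 2 * ∑ j, I.detour j * ((Finset.Ioc 0 (2 ^ m)).filter (2 ^ I.level j ∣ ·)).card := by
          rw [← Finset.mul_sum, Finset.sum_comm]
          congr 1
          refine Finset.sum_congr rfl fun j _ => ?_
          rw [← Finset.sum_filter, Finset.sum_const, nsmul_eq_mul, mul_comm]
          rfl
      _ ≤ 2 * ∑ j, I.detour j / 2 ^ I.level j * 2 ^ m := by
          refine mul_le_mul_of_nonneg_left (Finset.sum_le_sum fun j _ => ?_) zero_le_two
          rw [Nat.Ioc_filter_dvd_card_eq_div, div_mul_eq_mul_div, mul_div_assoc]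
          refine mul_le_mul_of_nonneg_left ?_ (Instance.detour_nonneg j)
          refine Nat.cast_div_le.trans_eq ?_
          push_cast
          rfl
      _ = 2 * (∑ j, I.detour j / 2 ^ I.level j) * 2 ^ m := by rw [← Finset.sum_mul, mul_assoc]

end Output

/-! ### Polynomial running time in the input size. -/

/-- Each turnover time is below `2` to its number of digits, and `a + b < (a + 1) * (b + 1)` is
applied unless both sides are bounded already by the product of powers. Hence the number of levels
is at most the input size, although the turnover times may be exponential in it. -/
theorem Instance.sum_turnover_lt (I : Instance) : ∑ j, I.turnover j < 2 ^ I.size := by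
  have key : ∀ A : Finset (Fin I.numClients),
      ∑ j ∈ A, I.turnover j < 2 ^ ∑ j ∈ A, Nat.size (I.turnover j) := by
    classical
    intro A
    induction A using Finset.induction_on with
    | empty => simp
    | insert j A hj ih =>
      rw [Finset.sum_insert hj, Finset.sum_insert hj, pow_add]
      have h1 := Nat.lt_size_self (I.turnover j)
      have h2 := Nat.mul_le_mul (Nat.succ_le_of_lt h1) (Nat.succ_le_of_lt ih)
      rw [Nat.succ_mul, Nat.mul_succ] at h2
      omega
  exact (key Finset.univ).trans_le (Nat.pow_le_pow_right two_pos (Nat.le_add_left _ _))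

theorem Instance.numClients_le_size (I : Instance) : I.numClients ≤ I.size := by
  have := Nat.le_self_pow two_ne_zero (I.numClients + 1)
  unfold size numVertices
  omega

theorem approxTime_mono {n N : ℕ} (h : n ≤ N) : approxTime n N ≤ approxTime N N := by
  unfold approxTime oneLevelTime addLevelTime addClientTime insertPathTime bellmanTime
  gcongr

theorem exists_polynomial_eval_eq_approxTime :
    ∃ p : Polynomial ℕ, ∀ N, p.eval N = approxTime N N := by
  let X : Polynomial ℕ := Polynomial.X
  let L : Polynomial ℕ := X * (2 * X * X)
  let bellmanPoly : Polynomial ℕ :=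
    (X + 1) * 3 + 2 + (X * ((X + 1) * ((X + 1) * 5 + 3 + 2) + 2 + 2) + 2 + 1 + 1)
  let pathPoly : Polynomial ℕ := X * ((L + 1) * 3 + 4 + 1 + 1 + 1 + 2) + 2
  let clientPoly : Polynomial ℕ := bellmanPoly + (((L + 1) * 4 + 3) + pathPoly)
  let levelPoly : Polynomial ℕ := X * (clientPoly + 1 + 1 + 2) + 2 + ((L + 1) * 3 + 3 + 2)
  refine ⟨X * 3 + 2 + (X * (levelPoly + 1) + 1 + 1 + 1), fun N => ?_⟩
  simp [X, L, bellmanPoly, pathPoly, clientPoly, levelPoly, approxTime, oneLevelTime, addLevelTime,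
    addClientTime, insertPathTime, bellmanTime]

end RFTT

/-- Min-avg RFTT on general weighted graphs has a deterministic polynomial time
`O(log n)`-approximation algorithm, whose solutions are synchronized. -/
theorem mainTheorem2 :
    ∃ (P : RFTT.Program) (p : Polynomial ℕ) (C : ℝ), ∀ I : RFTT.Instance,
      ∃ (t : ℕ) (s : RFTT.State) (S : RFTT.Solution I),
        RFTT.Exec P I.input t s ∧
        t ≤ p.eval I.size ∧
        S.IsDescribedBy s ∧
        S.IsSynchronized ∧
        S.Feasible ∧
        ∀ S' : RFTT.Solution I, S'.Feasible →
          S.avgLength ≤ C * Real.log I.numVertices * S'.avgLength := by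
  obtain ⟨p, hp⟩ := RFTT.exists_polynomial_eval_eq_approxTime
  -- Of the factor `4`, one `2` is for walking each detour there and back, the other for rounding
  -- the turnover times.
  refine ⟨RFTT.approx, p, 4 * (1 / Real.log 2 + 1), fun I => ?_⟩
  obtain ⟨t, s, he, ht, m, hout⟩ := RFTT.runs_approx I I.size I.sum_turnover_lt
  obtain ⟨S, h1, h2, h3, h4⟩ := hout.exists_solution
  refine ⟨t, s, S, he, ?_, h1, h2, h3, fun S' hS' => ?_⟩
  · rw [hp]
    exact ht.trans (RFTT.approxTime_mono I.numClients_le_size)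
  · have h5 := hS'.sum_detour_le
    have h6 := mul_le_mul_of_nonneg_right (RFTT.harmonic_le_log I.numClients) S'.avgLength_nonneg
    change _ ≤ 4 * (1 / Real.log 2 + 1) * Real.log (I.numClients + 1 : ℕ) * S'.avgLength
    linarith
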